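/- Let $F_2$ be the free group on $x,y$. Abelianization $F_2\to\mathbb{Z}^2$ identifies $\mathrm{Out}(F_2)$ with $\mathrm{GL}_2(\mathbb{Z})$, so $\mathrm{SL}_2(\mathbb{Z})$ acts on the classes $[\varphi]$ modulo $\mathrm{Inn}(G)$ of surjections $\varphi:F_2\to G$ onto a finite group $G$ (through $[\varphi]\mapsto[\varphi\circ\gamma]$ for any automorphism $\gamma$ of $F_2$ inducing the given matrix). Let $\Gamma_{[\varphi]}\le\mathrm{SL}_2(\mathbb{Z})$ be the stabilizer of $[\varphi]$. For a finite index subgroup $\Gamma\le\mathrm{SL}_2(\mathbb{Z})$, let $\pm\Gamma$ be the subgroup generated by $\Gamma$ and $-I$. The width of the cusp $M\cdot\infty$ of $\Gamma$ ($M\in\mathrm{SL}_2(\mathbb{Z})$) is the least $n\ge1$ with $M\begin{pmatrix}1&1\\0&1\end{pmatrix}^nM^{-1}\in\pm\Gamma$, and the geometric level $l$ of $\Gamma$ is the least common multiple of its cusp widths. Let $p_l:\mathrm{SL}_2(\mathbb{Z})\to\mathrm{SL}_2(\mathbb{Z}/l\mathbb{Z})$ be reduction modulo $l$, and put $d=[\mathrm{SL}_2(\mathbb{Z}):\pm\Gamma]$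 and $e=[\mathrm{SL}_2(\mathbb{Z}/l\mathbb{Z}):p_l(\pm\Gamma)]$. Call $\Gamma$ totally noncongruence if $e=1$ and $d>1$, congruence if it contains $\ker p_n$ for some $n\ge1$, and noncongruence if it does not. A finite group $G$ that can be generated by two elements is called noncongruence if $\Gamma_{[\varphi]}$ is noncongruence for at least one surjection $\varphi:F_2\to G$. **Theorem.** Let $G$ be a nontrivial finite group generated by two elements $a,b$ such that the orders $|a|,|b|,|ab|$ are pairwise coprime, and let $\varphi:F_2\to G$ be the surjection with $\varphi(x)=a$, $\varphi(y)=b$. Then $\Gamma_{[\varphi]}$ is a subgroup of finite index which is totally noncongruence, and it is noncongruence. **Corollary.** For every prime $p\ge5$, the group $\mathrm{PSL}_2(\mathbb{F}_p)$ is noncongruence. -/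

import Mathlib

open scoped MatrixGroups

namespace NoncongruenceCriterion

/-- The abelianization `F₂ → ℤ²` of the free group `F₂` on two generators `x = of 0`, `y = of 1`,
sending a word to its vector of exponent sums. -/
def exponentSum : FreeGroup (Fin 2) →* Multiplicative (Fin 2 → ℤ) :=
  FreeGroup.lift fun i => Multiplicative.ofAdd (Pi.single i 1)

/-- The automorphism `γ` of `F₂` acts on the abelianization `ℤ²` (column vectors) through `M`. -/
def Induces (γ : MulAut (FreeGroup (Fin 2))) (M : SL(2, ℤ)) : Prop :=
  ∀ w : FreeGroup (Fin 2),
    (exponentSum (γ w)).toAdd = (M : Matrix (Fin 2) (Fin 2) ℤ).mulVec (exponentSum w).toAdd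

/-- Two homomorphisms `F₂ → G` define the same exterior homomorphism, that is, they have the same
class modulo `Inn(G)`. -/
def ExtEquiv {G : Type*} [Group G] (φ ψ : FreeGroup (Fin 2) →* G) : Prop :=
  ∃ g : G, ∀ w, ψ w = g * φ w * g⁻¹

/-- The stabilizer in `SL₂(ℤ)` of the class `[φ]` of `φ : F₂ → G` modulo `Inn(G)`. Abelianization
identifies `Out(F₂)` with `GL₂(ℤ)`, so that `M ∈ SL₂(ℤ)` acts by `[φ] ↦ [φ ∘ γ]`
for any automorphism `γ` of `F₂` inducing `M` on `ℤ²` (the choice of `γ` does not matter);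
the stabilizer of a class is the same for this right action and for the left action obtained
from it by inversion. -/
def stabilizer {G : Type*} [Group G] (φ : FreeGroup (Fin 2) →* G) : Subgroup SL(2, ℤ) where
  carrier := {M | ∃ γ : MulAut (FreeGroup (Fin 2)),
    Induces γ M ∧ ExtEquiv φ (φ.comp γ.toMonoidHom)}
  one_mem' := ⟨1, fun w => by simp, 1, fun w => by simp⟩
  mul_mem' := by
    rintro M N ⟨γ, hγ, g, hg⟩ ⟨δ, hδ, h, hh⟩
    refine ⟨γ * δ, fun w => ?_, g * h, fun w => ?_⟩
    · rw [MulAut.mul_apply, hγ, hδ, Matrix.mulVec_mulVec, Matrix.SpecialLinearGroup.coe_mul]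
    · have h1 := hg (δ w)
      have h2 := hh w
      simp only [MonoidHom.comp_apply, MulEquiv.toMonoidHom_eq_coe, MonoidHom.coe_coe] at h1 h2
      simp [h1, h2, mul_assoc]
  inv_mem' := by
    rintro M ⟨γ, hγ, g, hg⟩
    refine ⟨γ⁻¹, fun w => ?_, g⁻¹, fun w => ?_⟩
    · have h := hγ (γ⁻¹ w)
      rw [MulAut.apply_inv_self] at h
      rw [h, Matrix.mulVec_mulVec, ← Matrix.SpecialLinearGroup.coe_mul, inv_mul_cancel]
      simp
    · have h := hg (γ⁻¹ w)
      simp only [MonoidHom.comp_apply, MulEquiv.toMonoidHom_eq_coe, MonoidHom.coe_coe,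
        MulAut.apply_inv_self] at h
      simp [h, mul_assoc]

/-- `±Γ`, the subgroup generated by `Γ` and `-I`. -/
def pm (Γ : Subgroup SL(2, ℤ)) : Subgroup SL(2, ℤ) := Γ ⊔ Subgroup.zpowers (-1)

/-- The width of the cusp `M·∞` of `Γ`, for `M ∈ SL₂(ℤ)`: the least `n ≥ 1` with
`M Tⁿ M⁻¹ ∈ ±Γ`, where `T = [1, 1; 0, 1]`. Every cusp is of the form `M·∞`. -/
noncomputable def cuspWidth (Γ : Subgroup SL(2, ℤ)) (M : SL(2, ℤ)) : ℕ :=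
  sInf {n : ℕ | 1 ≤ n ∧ M * ModularGroup.T ^ n * M⁻¹ ∈ pm Γ}

/-- The geometric level of a finite index subgroup `Γ`: the least common multiple of its cusp
widths. -/
noncomputable def geometricLevel (Γ : Subgroup SL(2, ℤ)) : ℕ :=
  sInf {l : ℕ | 1 ≤ l ∧ ∀ M : SL(2, ℤ), cuspWidth Γ M ∣ l}

/-- Reduction modulo `l`, `p_l : SL₂(ℤ) → SL₂(ℤ/l)`. -/
def reduction (l : ℕ) : SL(2, ℤ) →* SL(2, ZMod l) :=
  Matrix.SpecialLinearGroup.map (Int.castRingHom (ZMod l))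

/-- A subgroup of finite index in `SL₂(ℤ)` that contains no principal congruence subgroup `Γ(n)`,
`n ≥ 1`. -/
def IsNoncongruenceSubgroup (Γ : Subgroup SL(2, ℤ)) : Prop :=
  Γ.FiniteIndex ∧ ¬ CongruenceSubgroup.IsCongruenceSubgroup Γ

/-- `Γ` has finite index, and with `l` its geometric level, `d = [SL₂(ℤ) : ±Γ]` and
`e = [SL₂(ℤ/l) : p_l(±Γ)]`, one has `e = 1` and `d > 1`. -/
def IsTotallyNoncongruence (Γ : Subgroup SL(2, ℤ)) : Prop :=
  Γ.FiniteIndex ∧ ((pm Γ).map (reduction (geometricLevel Γ))).index = 1 ∧ 1 < (pm Γ).index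

/-- `G` is purely congruence: the stabilizer of every surjection `F₂ → G` is a congruence
subgroup. -/
def IsPurelyCongruence (G : Type*) [Group G] : Prop :=
  ∀ φ : FreeGroup (Fin 2) →* G, Function.Surjective φ →
    CongruenceSubgroup.IsCongruenceSubgroup (stabilizer φ)

/-- `G` is a noncongruence group: a finite group, generated by two elements, that is not purely
congruence. -/
def IsNoncongruenceGroup (G : Type*) [Group G] : Prop :=
  Finite G ∧ (∃ a b : G, Subgroup.closure {a, b} = ⊤) ∧ ¬ IsPurelyCongruence G

end NoncongruenceCriterion

/-!
Let `Γ` be the stabilizer of the class of `φ : F₂ → G`, where `φ x = a` and `φ y = b`.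

*`Γ` is large modulo every `l`.* The automorphism `y ↦ x ^ n * y` fixes `φ` when `n` is a multiple
of the order of `a`, so `Γ` contains `T ^ |a|`; in the same way it contains `L ^ |b|` and
`U ^ |ab|`, where `T`, `L`, `U` are the unipotent matrices fixing `(1, 0)`, `(0, 1)`, `(1, 1)`. By
coprimality, over each local factor of `ℤ/l` at least two of these three elements generate the
same groups as `T`, `L`, `U` themselves, and any two of `T`, `L`, `U` generate `SL₂`. Hence `Γ`
surjects onto `SL₂(ℤ/l)` for every `l ≥ 1` (`map_reduction_eq_top`; idempotents of the ring replace its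
decomposition into local factors). A proper subgroup of finite index with this property is
noncongruence, and totally noncongruence if `±Γ` is proper too.

*`±Γ` is proper.* If `±Γ` contained `S`, some automorphism inducing `±S` would fix the class of `φ`.
Automorphisms inducing the same matrix differ by an inner one (`inner_of_induces_one`), so this
automorphism maps `x` to a conjugate of `y` or `y⁻¹`. Then `a` and `b` have the same order, which by
coprimality is `1`, and `G` is trivial.

*Automorphisms of `F₂` acting trivially on `ℤ²` are inner.* Nielsen reduction shows that `Aut(F₂)`
is generated by elementary automorphisms and inner ones (`nielsen_eq_top`). It is carried out with
Gromov products in the Cayley tree: if `|γ x| + |γ y|` cannot be decreased by a Nielsen move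
followed by a conjugation, then `γ x` and `γ y` have so little cancellation
(`nielsenReduced_of_minimal`) that `|w| ≤ |γ w|` for every word `w`, and so `γ` permutes the letters.
Modulo inner automorphisms the lifts `s`, `t` of `S`, `T` satisfy the relations of `SL₂(ℤ)`, which
bring every product of them to a normal form built around a word in the positive matrices `T` and
`L = T * S * T` (`exists_normal_form`). As positive words have nonnegative entries that grow with
their length, only the trivial normal form gives the identity matrix (`normal_form_eq_one`).

For `PSL₂(𝔽_p)` the criterion is applied to the images of `S` and `S * T`, of orders `2` and `3`,
whose product is the image of `T`, of order `p`.
-/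

open scoped MatrixGroups

namespace NoncongruenceCriterion

/-! ### Gromov products in free groups -/

section GromovProduct

variable {α : Type*} [DecidableEq α]

/-- Twice the Gromov product of `u` and `v` based at `1` in the Cayley tree of a free group, that
is, twice the length of the longest common prefix of the reduced words `u` and `v`. -/
def gromov (u v : FreeGroup α) : ℤ := u.norm + v.norm - (u⁻¹ * v).norm

theorem norm_inv_mul_le_of_append {u v : FreeGroup α} {p s t : List (α × Bool)}
    (hu : u.toWord = p ++ s) (hv : v.toWord = p ++ t) :
    (u⁻¹ * v).norm ≤ s.length + t.length := by
  have hu' : u = FreeGroup.mk p * FreeGroup.mk s := by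
    rw [FreeGroup.mul_mk, ← hu, FreeGroup.mk_toWord]
  have hv' : v = FreeGroup.mk p * FreeGroup.mk t := by
    rw [FreeGroup.mul_mk, ← hv, FreeGroup.mk_toWord]
  have h : u⁻¹ * v = (FreeGroup.mk s)⁻¹ * FreeGroup.mk t := by rw [hu', hv']; group
  rw [h]
  refine (FreeGroup.norm_mul_le _ _).trans (add_le_add ?_ FreeGroup.norm_mk_le)
  rw [FreeGroup.norm_inv_eq]
  exact FreeGroup.norm_mk_le

theorem two_mul_length_le_gromov {u v : FreeGroup α} {p s t : List (α × Bool)}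
    (hu : u.toWord = p ++ s) (hv : v.toWord = p ++ t) : 2 * (p.length : ℤ) ≤ gromov u v := by
  have h := norm_inv_mul_le_of_append hu hv
  have h1 : u.norm = p.length + s.length := by rw [FreeGroup.norm, hu, List.length_append]
  have h2 : v.norm = p.length + t.length := by rw [FreeGroup.norm, hv, List.length_append]
  unfold gromov
  omega

theorem exists_common_prefix {β : Type*} (l m : List β) :
    ∃ p s t, l = p ++ s ∧ m = p ++ t ∧ ∀ a ∈ s.head?, ∀ b ∈ t.head?, a ≠ b := by
  induction l generalizing m with
  | nil => exact ⟨[], [], m, by simp⟩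
  | cons a l ih =>
    cases m with
    | nil => exact ⟨[], a :: l, [], by simp⟩
    | cons b m =>
      by_cases hab : a = b
      · obtain ⟨p, s, t, rfl, rfl, h⟩ := ih m
        exact ⟨a :: p, s, t, by simp, by simp [hab], h⟩
      · exact ⟨[], a :: l, b :: m, by simp, by simp, by simpa using hab⟩

theorem isReduced_invRev_append {s t : List (α × Bool)} (hs : FreeGroup.IsReduced s)
    (ht : FreeGroup.IsReduced t) (h : ∀ a ∈ s.head?, ∀ b ∈ t.head?, a ≠ b) :
    FreeGroup.IsReduced (FreeGroup.invRev s ++ t) := by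
  have hs' : FreeGroup.IsReduced (FreeGroup.invRev s) := by
    rw [FreeGroup.isReduced_iff_reduce_eq, FreeGroup.reduce_invRev, hs.reduce_eq]
  refine List.IsChain.append hs' ht ?_
  intro x hx y hy hxy
  have hx' : ∃ a ∈ s.head?, x = (a.1, !a.2) := by
    simpa [FreeGroup.invRev, List.getLast?_reverse, eq_comm] using hx
  obtain ⟨a, ha, rfl⟩ := hx'
  have := h a ha y hy
  by_contra hne
  refine this (Prod.ext hxy ?_)
  revert hne
  cases a.2 <;> cases y.2 <;> simp

/-- The Gromov product is the length of the longest common prefix. -/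
theorem exists_gromov_eq (u v : FreeGroup α) : ∃ p s t : List (α × Bool),
    u.toWord = p ++ s ∧ v.toWord = p ++ t ∧ gromov u v = 2 * (p.length : ℤ) := by
  obtain ⟨p, s, t, hu, hv, h⟩ := exists_common_prefix u.toWord v.toWord
  refine ⟨p, s, t, hu, hv, ?_⟩
  have hs : FreeGroup.IsReduced s :=
    (FreeGroup.isReduced_toWord (x := u)).infix ⟨p, [], by simp [hu]⟩
  have ht : FreeGroup.IsReduced t :=
    (FreeGroup.isReduced_toWord (x := v)).infix ⟨p, [], by simp [hv]⟩
  have hu' : u = FreeGroup.mk p * FreeGroup.mk s := by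
    rw [FreeGroup.mul_mk, ← hu, FreeGroup.mk_toWord]
  have hv' : v = FreeGroup.mk p * FreeGroup.mk t := by
    rw [FreeGroup.mul_mk, ← hv, FreeGroup.mk_toWord]
  have h3 : u⁻¹ * v = FreeGroup.mk (FreeGroup.invRev s ++ t) := by
    rw [← FreeGroup.mul_mk, ← FreeGroup.inv_mk, hu', hv']; group
  have h4 : (u⁻¹ * v).norm = s.length + t.length := by
    rw [h3, FreeGroup.norm, FreeGroup.toWord_mk, (isReduced_invRev_append hs ht h).reduce_eq,
      List.length_append, FreeGroup.invRev_length]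
  have h1 : u.norm = p.length + s.length := by rw [FreeGroup.norm, hu, List.length_append]
  have h2 : v.norm = p.length + t.length := by rw [FreeGroup.norm, hv, List.length_append]
  unfold gromov
  omega

theorem even_gromov (u v : FreeGroup α) : ∃ n : ℕ, gromov u v = 2 * (n : ℤ) := by
  obtain ⟨p, _, _, _, _, h⟩ := exists_gromov_eq u v
  exact ⟨p.length, h⟩

theorem gromov_comm (u v : FreeGroup α) : gromov u v = gromov v u := by
  have : (u⁻¹ * v).norm = (v⁻¹ * u).norm := by
    rw [← FreeGroup.norm_inv_eq]; simp
  unfold gromov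
  omega

/-- The Cayley tree of a free group is `0`-hyperbolic. -/
theorem gromov_hyperbolic (u v w : FreeGroup α) :
    gromov u v ≤ gromov u w ∨ gromov v w ≤ gromov u w := by
  obtain ⟨p, s, t, hu, hv, h⟩ := exists_gromov_eq u v
  obtain ⟨q, s', t', hv', hw, h'⟩ := exists_gromov_eq v w
  rcases List.append_eq_append_iff.1 (hv.symm.trans hv') with ⟨a, ha, _⟩ | ⟨a, ha, _⟩
  · left
    rw [h]
    exact two_mul_length_le_gromov hu (hw.trans (by rw [ha, List.append_assoc]))
  · right
    rw [h']
    exact two_mul_length_le_gromov (hu.trans (by rw [ha, List.append_assoc])) hw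

/-- A geodesic from `1` to `g` has a vertex at each distance `n ≤ |g|` from `1`. -/
theorem exists_norm_eq_and_norm_inv_mul_eq (g : FreeGroup α) {n : ℕ} (hn : n ≤ g.norm) :
    ∃ h : FreeGroup α, h.norm = n ∧ (h⁻¹ * g).norm + n = g.norm := by
  have hg := FreeGroup.isReduced_toWord (x := g)
  have h1 : (FreeGroup.mk (g.toWord.take n)).norm = n := by
    rw [FreeGroup.norm, FreeGroup.toWord_mk,
      (hg.infix (List.take_prefix n _).isInfix).reduce_eq, List.length_take]
    exact min_eq_left hn
  refine ⟨FreeGroup.mk (g.toWord.take n), h1, ?_⟩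
  have h2 : (FreeGroup.mk (g.toWord.take n))⁻¹ * g = FreeGroup.mk (g.toWord.drop n) := by
    rw [inv_mul_eq_iff_eq_mul, FreeGroup.mul_mk, List.take_append_drop, FreeGroup.mk_toWord]
  rw [h2, FreeGroup.norm, FreeGroup.toWord_mk,
      (hg.infix (List.drop_suffix n _).isInfix).reduce_eq, List.length_drop]
  exact Nat.sub_add_cancel hn

/-- A nontrivial element acts freely on the tree, so squaring it increases the length. -/
theorem norm_lt_norm_mul_self {g : FreeGroup α} (hg : g ≠ 1) : g.norm < (g * g).norm := by
  open FreeGroup FreeGroup.reduceCyclically in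
  have h := reduce_flatten_replicate_succ (isReduced_toWord (x := g)) 1
  have h0 := conj_conjugator_reduceCyclically g.toWord
  have h1 : (g * g).norm = (FreeGroup.reduce (List.replicate (1 + 1) g.toWord).flatten).length := by
    rw [FreeGroup.norm, toWord_mul]; simp
  have h2 : reduceCyclically g.toWord ≠ [] := by
    intro h3
    apply hg
    rw [h3] at h0
    have h4 : FreeGroup.mk (conjugator g.toWord ++ [] ++ invRev (conjugator g.toWord)) = 1 := by
      rw [List.append_nil, ← mul_mk, ← inv_mk, mul_inv_cancel]
    rw [h0, mk_toWord] at h4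
    exact h4
  have h3 := List.length_pos_iff.2 h2
  have h4 := congrArg List.length h0
  rw [h1, h]
  have h5 : g.norm = g.toWord.length := rfl
  simp at h4 ⊢
  omega

theorem gromov_inv_self_lt {g : FreeGroup α} (hg : g ≠ 1) : gromov g⁻¹ g < g.norm := by
  have := norm_lt_norm_mul_self hg
  unfold gromov
  rw [FreeGroup.norm_inv_eq, inv_inv]
  omega

end GromovProduct

/-! ### Nielsen reduced families do not shorten words -/

section Nielsen

variable {α β : Type*} [DecidableEq β]

/-- A family of elements, indexed by the letters `x^{±1}`, that is Nielsen reduced: in a product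
of two letters that may be adjacent in a reduced word, at most half of the second one cancels, and
in a product of three consecutive letters some part of the middle one survives. -/
structure NielsenReduced (f : α × Bool → FreeGroup β) : Prop where
  ne_one : ∀ c, f c ≠ 1
  le_right : ∀ c d : α × Bool, (c.1 = d.1 → c.2 = d.2) → gromov (f c)⁻¹ (f d) ≤ (f d).norm
  lt_middle : ∀ b c d : α × Bool, (b.1 = c.1 → b.2 = c.2) → (c.1 = d.1 → c.2 = d.2) →
    gromov (f b)⁻¹ (f c) + gromov (f c)⁻¹ (f d) < 2 * (f c).norm

theorem gromov_inv_left (u v : FreeGroup β) :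
    gromov u⁻¹ v = u.norm + v.norm - (u * v).norm := by
  rw [gromov, inv_inv, FreeGroup.norm_inv_eq]

/-- For a Nielsen reduced family, the cancellation between a letter and a word only depends on the
first letter of the word, and every letter of a word contributes to its length. -/
theorem NielsenReduced.gromov_prod {f : α × Bool → FreeGroup β} (hf : NielsenReduced f)
    (L : List (α × Bool)) (c : α × Bool) (hL : FreeGroup.IsReduced (c :: L)) (b : α × Bool)
    (hb : b.1 = c.1 → b.2 = c.2) :
    gromov (f b)⁻¹ ((c :: L).map f).prod = gromov (f b)⁻¹ (f c) ∧
    2 * ((L.length : ℤ) + 1) ≤ 2 * ((c :: L).map f).prod.norm - gromov (f b)⁻¹ (f c) := by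
  induction L generalizing b c with
  | nil =>
    have h1 := hf.le_right b c hb
    have h2 : 0 < (f c).norm := Nat.pos_of_ne_zero fun h => hf.ne_one c (FreeGroup.norm_eq_zero.1 h)
    obtain ⟨n, h3⟩ := even_gromov (f b)⁻¹ (f c)
    simp only [List.map_cons, List.map_nil, List.prod_cons, List.prod_nil, mul_one,
      List.length_nil, true_and]
    omega
  | cons d L ih =>
    rw [FreeGroup.IsReduced, List.isChain_cons_cons] at hL
    obtain ⟨ih1, ih2⟩ := ih d hL.2 c hL.1
    rw [List.map_cons, List.prod_cons]
    set g := ((d :: L).map f).prod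
    have h1 := hf.lt_middle b c d hb hL.1
    have h2 : gromov (f c) (f c * g) = 2 * (f c).norm - gromov (f c)⁻¹ (f d) := by
      rw [gromov_inv_left] at ih1
      rw [gromov, inv_mul_cancel_left]
      omega
    have h3 := gromov_hyperbolic (f b)⁻¹ (f c) (f c * g)
    have h4 := gromov_hyperbolic (f b)⁻¹ (f c * g) (f c)
    rw [gromov_comm (f c * g)] at h4
    obtain ⟨n, h5⟩ := even_gromov (f b)⁻¹ (f c)
    obtain ⟨m, h6⟩ := even_gromov (f c)⁻¹ (f d)
    rw [gromov_inv_left (f c) g] at ih1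
    refine ⟨by omega, ?_⟩
    rw [List.length_cons]
    push_cast
    omega

theorem NielsenReduced.length_le_norm_prod {f : α × Bool → FreeGroup β} (hf : NielsenReduced f)
    (L : List (α × Bool)) (hL : FreeGroup.IsReduced L) : L.length ≤ (L.map f).prod.norm := by
  cases L with
  | nil => simp
  | cons c L =>
    obtain ⟨-, h⟩ := hf.gromov_prod L c hL c (fun _ => rfl)
    obtain ⟨n, h1⟩ := even_gromov (f c)⁻¹ (f c)
    rw [List.length_cons]
    omega

/-- If `c` cancels half of its length on either side against `a`, as in `a * c * a`, then a common
conjugation shortens the pair `(c, a * c)`: writing `c = h * k⁻¹` with `h`, `k` of equal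
length, the reduced form of `a` is `k * m * h⁻¹`. -/
theorem exists_conj_norm_le {a c : FreeGroup β} (hac : c.norm ≤ a.norm)
    (h1 : (c.norm : ℤ) ≤ gromov a⁻¹ c) (h2 : (c.norm : ℤ) ≤ gromov c⁻¹ a)
    {n : ℕ} (hn : c.norm = 2 * n) :
    ∃ k : FreeGroup β, (k⁻¹ * c * k).norm ≤ c.norm ∧
      (k⁻¹ * (a * c) * k).norm + c.norm ≤ a.norm := by
  obtain ⟨h, hh1, hh2⟩ := exists_norm_eq_and_norm_inv_mul_eq c (n := n) (by omega)
  have hk : (c⁻¹ * h).norm = n := by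
    rw [← FreeGroup.norm_inv_eq]; simp; omega
  refine ⟨c⁻¹ * h, ?_, ?_⟩
  · have e : (c⁻¹ * h)⁻¹ * c * (c⁻¹ * h) = (h⁻¹ * c) * h := by group
    rw [e]
    have := FreeGroup.norm_mul_le (h⁻¹ * c) h
    omega
  · have e : (c⁻¹ * h)⁻¹ * (a * c) * (c⁻¹ * h) = (c⁻¹ * h)⁻¹ * (a * h) := by group
    rw [e]
    -- The vertices `k = c⁻¹ * h` and `a * h` both lie on the geodesic from `1` to `a`.
    have p1 : gromov c h = 2 * n := by
      have : (c⁻¹ * h).norm = n := hk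
      unfold gromov; omega
    have p2 := gromov_hyperbolic a⁻¹ c h
    have p3 : gromov a⁻¹ h = n + a.norm - (a * h).norm := by
      rw [gromov_inv_left]; omega
    have p4 : gromov c⁻¹ (c⁻¹ * h) = 2 * n := by
      rw [gromov, FreeGroup.norm_inv_eq, inv_inv, mul_inv_cancel_left]; omega
    have p5 := gromov_hyperbolic (c⁻¹ * h) c⁻¹ a
    rw [gromov_comm (c⁻¹ * h) c⁻¹] at p5
    have p6 := gromov_hyperbolic (c⁻¹ * h) a (a * h)
    have p7 : gromov a (a * h) = a.norm + (a * h).norm - n := by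
      rw [gromov, inv_mul_cancel_left]; omega
    have p8 := FreeGroup.norm_mul_le a⁻¹ (a * h)
    have p9 := FreeGroup.norm_mul_le (a * h) h⁻¹
    rw [mul_inv_cancel_right, FreeGroup.norm_inv_eq] at p9
    have p10 : gromov (c⁻¹ * h) (a * h) =
      n + (a * h).norm - ((c⁻¹ * h)⁻¹ * (a * h)).norm := by rw [gromov]; omega
    omega

/-- A family on two letters whose total length cannot be decreased by the Nielsen move
`(a, b) ↦ (a, a * b)`, followed by a simultaneous conjugation, is Nielsen reduced. -/
theorem nielsenReduced_of_minimal {f : Fin 2 × Bool → FreeGroup β}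
    (hinv : ∀ i b, f (i, !b) = (f (i, b))⁻¹) (hne : ∀ c, f c ≠ 1)
    (hmin : ∀ c d : Fin 2 × Bool, c.1 ≠ d.1 → ∀ k : FreeGroup β,
      (f c).norm + (f d).norm ≤ (k⁻¹ * f c * k).norm + (k⁻¹ * (f c * f d) * k).norm) :
    NielsenReduced f := by
  have hpos : ∀ c, 0 < (f c).norm := fun c =>
    Nat.pos_of_ne_zero fun h => hne c (FreeGroup.norm_eq_zero.1 h)
  have key : ∀ c d : Fin 2 × Bool, c.1 ≠ d.1 → (f d).norm ≤ (f c * f d).norm := by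
    intro c d hcd
    have := hmin c d hcd 1
    simp at this
    omega
  have key' : ∀ c d : Fin 2 × Bool, c.1 ≠ d.1 → (f c).norm ≤ (f c * f d).norm := by
    intro c d hcd
    have := key (d.1, !d.2) (c.1, !c.2) (Ne.symm hcd)
    rw [hinv, hinv, ← mul_inv_rev, FreeGroup.norm_inv_eq, FreeGroup.norm_inv_eq] at this
    exact this
  have same : ∀ c d : Fin 2 × Bool, (c.1 = d.1 → c.2 = d.2) → c.1 = d.1 → c = d :=
    fun c d h h' => Prod.ext h' (h h')
  have hself : ∀ c, gromov (f c)⁻¹ (f c) < (f c).norm := fun c => gromov_inv_self_lt (hne c)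
  have hl : ∀ c d : Fin 2 × Bool, (c.1 = d.1 → c.2 = d.2) →
      gromov (f c)⁻¹ (f d) ≤ (f c).norm := by
    intro c d h
    by_cases hcd : c.1 = d.1
    · obtain rfl := same c d h hcd
      exact (hself c).le
    · have := key c d hcd
      rw [gromov_inv_left]; omega
  have hr : ∀ c d : Fin 2 × Bool, (c.1 = d.1 → c.2 = d.2) →
      gromov (f c)⁻¹ (f d) ≤ (f d).norm := by
    intro c d h
    by_cases hcd : c.1 = d.1
    · obtain rfl := same c d h hcd
      exact (hself c).le
    · have := key' c d hcd
      rw [gromov_inv_left]; omega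
  refine ⟨hne, hr, ?_⟩
  intro b c d hbc hcd
  have h1 := hr b c hbc
  have h2 := hl c d hcd
  by_cases e1 : b.1 = c.1
  · obtain rfl := same b c hbc e1
    have := hself b
    omega
  by_cases e2 : c.1 = d.1
  · obtain rfl := same c d hcd e2
    have := hself c
    omega
  by_contra hcon
  have h3 : gromov (f b)⁻¹ (f c) = (f c).norm := by omega
  have h4 : gromov (f c)⁻¹ (f d) = (f c).norm := by omega
  have e3 : b.1 = d.1 := by omega
  by_cases e4 : b.2 = d.2
  · obtain rfl : b = d := Prod.ext e3 e4
    obtain ⟨n, hn⟩ := even_gromov (f b)⁻¹ (f c)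
    have h5 := hl b c hbc
    obtain ⟨k, hk1, hk2⟩ := exists_conj_norm_le (a := f b) (c := f c) (by omega) h3.ge h4.ge
      (n := n) (by omega)
    have h6 := hmin (c.1, !c.2) (b.1, !b.2) (Ne.symm e1) k
    have e5 : k⁻¹ * (f c)⁻¹ * k = (k⁻¹ * f c * k)⁻¹ := by group
    have e6 : k⁻¹ * ((f c)⁻¹ * (f b)⁻¹) * k = (k⁻¹ * (f b * f c) * k)⁻¹ := by group
    rw [hinv, hinv, e5, e6] at h6
    simp only [FreeGroup.norm_inv_eq, Prod.mk.eta] at h6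
    have := hpos c
    omega
  · have e5 : d = (b.1, !b.2) := by
      refine Prod.ext e3.symm ?_
      revert e4
      cases b.2 <;> cases d.2 <;> simp
    rw [e5, hinv, Prod.mk.eta] at h4
    have h5 := gromov_hyperbolic (f c) (f b)⁻¹ (f c)⁻¹
    have h6 := hself c
    rw [gromov_comm] at h6
    rw [gromov_comm (f c) (f b)⁻¹, gromov_comm (f b)⁻¹ (f c)⁻¹] at h5
    omega

end Nielsen

/-! ### Automorphisms of `F₂` -/

section Automorphisms

local notation "F₂" => FreeGroup (Fin 2)

/-- The endomorphism of `F₂` with `x ↦ u` and `y ↦ v`. -/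
def endOf (u v : F₂) : F₂ →* F₂ := FreeGroup.lift ![u, v]

@[simp] theorem endOf_of_zero (u v : F₂) : endOf u v (FreeGroup.of 0) = u := by simp [endOf]

@[simp] theorem endOf_of_one (u v : F₂) : endOf u v (FreeGroup.of 1) = v := by simp [endOf]

theorem monoidHom_ext_two {M : Type*} [Monoid M] {φ ψ : F₂ →* M}
    (h0 : φ (FreeGroup.of 0) = ψ (FreeGroup.of 0)) (h1 : φ (FreeGroup.of 1) = ψ (FreeGroup.of 1)) :
    φ = ψ := by
  ext i
  fin_cases i
  · exact h0
  · exact h1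

theorem mulAut_ext_two {γ δ : MulAut F₂} (h0 : γ (FreeGroup.of 0) = δ (FreeGroup.of 0))
    (h1 : γ (FreeGroup.of 1) = δ (FreeGroup.of 1)) : γ = δ := by
  have : γ.toMonoidHom = δ.toMonoidHom := monoidHom_ext_two h0 h1
  ext w
  exact DFunLike.congr_fun this w

/-- The automorphism of `F₂` with `x ↦ u` and `y ↦ v`, whose inverse is `x ↦ u'` and `y ↦ v'`. -/
def autOf (u v u' v' : F₂) (h0 : endOf u' v' u = FreeGroup.of 0)
    (h1 : endOf u' v' v = FreeGroup.of 1) (h2 : endOf u v u' = FreeGroup.of 0)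
    (h3 : endOf u v v' = FreeGroup.of 1) : MulAut F₂ :=
  MonoidHom.toMulEquiv (endOf u v) (endOf u' v')
    (monoidHom_ext_two (by simp [h0]) (by simp [h1]))
    (monoidHom_ext_two (by simp [h2]) (by simp [h3]))

/-- The lift `x ↦ x`, `y ↦ x ^ n * y` of `T ^ n`. -/
def autT (n : ℤ) : MulAut F₂ :=
  autOf (.of 0) (.of 0 ^ n * .of 1) (.of 0) (.of 0 ^ (-n) * .of 1)
    (by simp) (by simp) (by simp) (by simp)

/-- The lift `x ↦ y`, `y ↦ x⁻¹` of `S`. -/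
def autS : MulAut F₂ :=
  autOf (.of 1) (.of 0)⁻¹ (.of 1)⁻¹ (.of 0) (by simp) (by simp) (by simp) (by simp)

/-- The automorphism `x ↦ x⁻¹`, `y ↦ y`, which reverses the orientation of `ℤ²`. -/
def autR : MulAut F₂ :=
  autOf (.of 0)⁻¹ (.of 1) (.of 0)⁻¹ (.of 1) (by simp) (by simp) (by simp) (by simp)

@[simp] theorem autT_of_zero (n : ℤ) : autT n (FreeGroup.of 0) = .of 0 := by simp [autT, autOf]

@[simp] theorem autT_of_one (n : ℤ) : autT n (FreeGroup.of 1) = .of 0 ^ n * .of 1 := by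
  simp [autT, autOf]

@[simp] theorem autS_of_zero : autS (FreeGroup.of 0) = .of 1 := by simp [autS, autOf]

@[simp] theorem autS_of_one : autS (FreeGroup.of 1) = (.of 0)⁻¹ := by simp [autS, autOf]

@[simp] theorem autR_of_zero : autR (FreeGroup.of 0) = (.of 0)⁻¹ := by simp [autR, autOf]

@[simp] theorem autR_of_one : autR (FreeGroup.of 1) = .of 1 := by simp [autR, autOf]

/-- The automorphisms generated by the lifts of `S` and `T` and the inner automorphisms. -/
def nielsenPlus : Subgroup (MulAut F₂) :=
  Subgroup.closure {autS, autT 1} ⊔ (MulAut.conj : F₂ →* MulAut F₂).range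

/-- The automorphisms generated by Nielsen moves and inner automorphisms. -/
def nielsen : Subgroup (MulAut F₂) := nielsenPlus ⊔ Subgroup.zpowers autR

theorem autS_mem_nielsenPlus : autS ∈ nielsenPlus :=
  Subgroup.mem_sup_left (Subgroup.subset_closure (by simp))

theorem autT_mem_nielsenPlus : autT 1 ∈ nielsenPlus :=
  Subgroup.mem_sup_left (Subgroup.subset_closure (by simp))

theorem conj_mem_nielsenPlus (g : F₂) : MulAut.conj g ∈ nielsenPlus :=
  Subgroup.mem_sup_right ⟨g, rfl⟩

theorem nielsenPlus_le_nielsen : nielsenPlus ≤ nielsen := le_sup_left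

theorem autR_mem_nielsen : autR ∈ nielsen :=
  Subgroup.mem_sup_right (Subgroup.mem_zpowers _)

theorem mk_not (i : Fin 2) (b : Bool) :
    FreeGroup.mk [(i, !b)] = (FreeGroup.mk [(i, b)] : F₂)⁻¹ := by
  simp [FreeGroup.inv_mk, FreeGroup.invRev]

/-- The signed permutations of the basis `x, y` are the products `S ^ k * R ^ m`. -/
theorem exists_mem_nielsen_of_letters (c d : Fin 2 × Bool) (hcd : c.1 ≠ d.1) :
    ∃ σ ∈ nielsen, σ (FreeGroup.of 0) = FreeGroup.mk [c] ∧
      σ (FreeGroup.of 1) = FreeGroup.mk [d] := by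
  have hs := nielsenPlus_le_nielsen autS_mem_nielsenPlus
  have hr := autR_mem_nielsen
  have e : ∀ i : Fin 2, FreeGroup.mk [(i, true)] = FreeGroup.of i := fun _ => rfl
  have e' : ∀ i : Fin 2, FreeGroup.mk [(i, false)] = (FreeGroup.of i)⁻¹ := fun _ => rfl
  obtain ⟨i, b⟩ := c
  obtain ⟨j, b'⟩ := d
  fin_cases i <;> fin_cases j <;> cases b <;> cases b' <;> simp at hcd <;> simp only [e, e']
  · exact ⟨autS * autS, mul_mem hs hs, by simp, by simp⟩
  · exact ⟨autR, hr, by simp, by simp⟩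
  · exact ⟨autS * autS * autR, mul_mem (mul_mem hs hs) hr, by simp, by simp⟩
  · exact ⟨1, one_mem _, by simp, by simp⟩
  · exact ⟨autS * autR, mul_mem hs hr, by simp, by simp⟩
  · exact ⟨autS * autS * autS, mul_mem (mul_mem hs hs) hs, by simp, by simp⟩
  · exact ⟨autS, hs, by simp, by simp⟩
  · exact ⟨autS * autS * autS * autR, mul_mem (mul_mem (mul_mem hs hs) hs) hr, by simp, by simp⟩

theorem map_eq_prod_letters (γ : MulAut F₂) (w : F₂) :
    γ w = (w.toWord.map fun c => γ (FreeGroup.mk [c])).prod := by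
  have h : ∀ L : List (Fin 2 × Bool),
      γ (FreeGroup.mk L) = (L.map fun c => γ (FreeGroup.mk [c])).prod := by
    intro L
    induction L with
    | nil => simp [← FreeGroup.one_eq_mk]
    | cons c L ih =>
      rw [List.map_cons, List.prod_cons, ← ih, ← map_mul, FreeGroup.mul_mk, List.singleton_append]
  rw [← h, FreeGroup.mk_toWord]

/-- An automorphism whose inverse does not lengthen words permutes the letters. -/
theorem mem_nielsen_of_norm_le {γ : MulAut F₂} (h : ∀ w : F₂, w.norm ≤ (γ w).norm) :
    γ ∈ nielsen := by
  have letter : ∀ i : Fin 2, ∃ c : Fin 2 × Bool, γ⁻¹ (FreeGroup.of i) = FreeGroup.mk [c] := by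
    intro i
    have h1 := h (γ⁻¹ (FreeGroup.of i))
    rw [MulAut.apply_inv_self, FreeGroup.norm_of] at h1
    have h2 : (γ⁻¹ (FreeGroup.of i)).norm ≠ 0 := by
      rw [Ne, FreeGroup.norm_eq_zero, EmbeddingLike.map_eq_one_iff]
      exact FreeGroup.of_ne_one i
    have h3 : (γ⁻¹ (FreeGroup.of i)).toWord.length = 1 := by
      rw [FreeGroup.norm] at h1 h2; omega
    obtain ⟨c, hc⟩ := List.length_eq_one_iff.1 h3
    exact ⟨c, by rw [← hc, FreeGroup.mk_toWord]⟩
  obtain ⟨c, hc⟩ := letter 0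
  obtain ⟨d, hd⟩ := letter 1
  have hcd : c.1 ≠ d.1 := by
    intro hcd
    have h1 : FreeGroup.mk [c] = FreeGroup.mk [d] ∨ FreeGroup.mk [c] = (FreeGroup.mk [d])⁻¹ := by
      obtain ⟨i, b⟩ := c
      obtain ⟨j, b'⟩ := d
      obtain rfl : i = j := hcd
      rw [← mk_not]
      cases b <;> cases b' <;> simp
    rw [← hc, ← hd, ← map_inv, γ⁻¹.injective.eq_iff, γ⁻¹.injective.eq_iff] at h1
    have h2 := h1.imp (congrArg FreeGroup.toWord) (congrArg FreeGroup.toWord)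
    simp [FreeGroup.toWord_inv, FreeGroup.invRev] at h2
  obtain ⟨σ, hσ, h0, h1⟩ := exists_mem_nielsen_of_letters c d hcd
  rw [← inv_mem_iff]
  have : γ⁻¹ = σ := mulAut_ext_two (hc.trans h0.symm) (hd.trans h1.symm)
  rwa [this]

/-- **Nielsen's theorem** for `F₂`: every automorphism is a product of Nielsen moves. -/
theorem nielsen_eq_top : nielsen = ⊤ := by
  rw [eq_top_iff]
  intro γ _
  induction hn : (γ (FreeGroup.of 0)).norm + (γ (FreeGroup.of 1)).norm
    using Nat.strong_induction_on generalizing γ with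
  | _ n ih =>
    by_cases hmin : ∀ δ ∈ nielsen,
        n ≤ ((γ * δ) (FreeGroup.of 0)).norm + ((γ * δ) (FreeGroup.of 1)).norm
    · let f : Fin 2 × Bool → F₂ := fun c => γ (FreeGroup.mk [c])
      have hinv : ∀ i b, f (i, !b) = (f (i, b))⁻¹ := fun i b => by
        simp only [f, mk_not, map_inv]
      have hnorm : ∀ i b, (f (i, b)).norm = (γ (FreeGroup.of i)).norm := by
        intro i b
        cases b
        · rw [← FreeGroup.norm_inv_eq, ← hinv]; rfl
        · rfl
      have hf : NielsenReduced f := by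
        refine nielsenReduced_of_minimal hinv (fun c => ?_) (fun c d hcd k => ?_)
        · simp only [f, Ne, EmbeddingLike.map_eq_one_iff, ← FreeGroup.toWord_eq_nil_iff,
            FreeGroup.toWord_mk, FreeGroup.reduce_singleton, List.cons_ne_nil, not_false_eq_true]
        · obtain ⟨σ, hσ, h0, h1⟩ := exists_mem_nielsen_of_letters c d hcd
          have h2 := hmin (MulAut.conj (γ⁻¹ k⁻¹) * (σ * autT 1))
            (mul_mem (nielsenPlus_le_nielsen (conj_mem_nielsenPlus _))
              (mul_mem hσ (nielsenPlus_le_nielsen autT_mem_nielsenPlus)))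
          have h3 : (f c).norm + (f d).norm = n := by
            obtain ⟨i, b⟩ := c
            obtain ⟨j, b'⟩ := d
            rw [hnorm, hnorm, ← hn]
            simp only at hcd
            fin_cases i <;> fin_cases j <;> simp at hcd ⊢
            exact add_comm _ _
          rw [h3]
          simpa [h0, h1, MulAut.conj_apply, f, mul_assoc, -FreeGroup.mul_mk] using h2
      refine mem_nielsen_of_norm_le fun w => ?_
      have := hf.length_le_norm_prod w.toWord FreeGroup.isReduced_toWord
      rwa [← map_eq_prod_letters] at this
    · push Not at hmin
      obtain ⟨δ, hδ, h⟩ := hmin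
      have := ih _ h (γ := γ * δ) (Subgroup.mem_top _) rfl
      exact (mul_mem_cancel_right hδ).1 this

end Automorphisms

/-! ### Automorphisms acting trivially on the abelianization are inner -/

section NormalForm

/-- In a group generated by `s` and `t` with the relations of `S` and `T` in `SL₂(ℤ)`, every element
is, up to powers of `s ^ 2`, a word in the positive letters `t` and `t * s * t`, preceded by one of
three powers of `s * t` and followed by one of two powers of `s`. -/
theorem exists_normal_form {O : Type*} [Group O] {s t : O} (hz : s * s * (s * s) = 1)
    (hc : s * s * t = t * (s * s)) (h3 : (s * t) ^ 3 = s * s) {g : O}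
    (hg : g ∈ Subgroup.closure {s, t}) :
    ∃ (e i j : ℕ) (w : List Bool), i < 3 ∧ j < 2 ∧
      g = (s * s) ^ e * (s * t) ^ i * (w.map fun b => if b then t else t * s * t).prod * s ^ j := by
  let N : O → Prop := fun g => ∃ (e i j : ℕ) (w : List Bool), i < 3 ∧ j < 2 ∧
      g = (s * s) ^ e * (s * t) ^ i * (w.map fun b => if b then t else t * s * t).prod * s ^ j
  have cs : ∀ e : ℕ, s * (s * s) ^ e = (s * s) ^ e * s := fun e =>
    ((Commute.refl s).mul_right (Commute.refl s)).pow_right e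
  have ct : ∀ e : ℕ, t * (s * s) ^ e = (s * s) ^ e * t := fun e =>
    Commute.pow_right (show Commute t (s * s) from hc.symm) e
  have Nz : ∀ g, N g → N (s * s * g) := by
    rintro _ ⟨e, i, j, w, hi, hj, rfl⟩
    refine ⟨e + 1, i, j, w, hi, hj, ?_⟩
    rw [pow_succ']
    simp only [mul_assoc]
  have Nu : ∀ g, N g → N (s * t * g) := by
    rintro _ ⟨e, i, j, w, hi, hj, rfl⟩
    have c : ∀ a : O, s * t * ((s * s) ^ e * a) = (s * s) ^ e * (s * t * a) := by
      intro a
      rw [mul_assoc s t, ← mul_assoc t, ct, ← mul_assoc s, ← mul_assoc s, cs]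
      simp only [mul_assoc]
    obtain hi' | rfl : i + 1 < 3 ∨ i = 2 := by omega
    · refine ⟨e, i + 1, j, w, hi', hj, ?_⟩
      simp only [mul_assoc ((s * s) ^ e), c]
      rw [pow_succ']
      simp only [mul_assoc]
    · refine ⟨e + 1, 0, j, w, by omega, hj, ?_⟩
      simp only [mul_assoc ((s * s) ^ e), c]
      rw [pow_succ _ e, ← h3, pow_succ' _ 2, pow_zero]
      simp only [mul_assoc, one_mul]
  have Ns : ∀ g, N g → N (s * g) := by
    rintro _ ⟨e, i, j, w, hi, hj, rfl⟩
    have c : ∀ a : O, s * ((s * s) ^ e * a) = (s * s) ^ e * (s * a) := by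
      intro a
      rw [← mul_assoc, cs, mul_assoc]
    interval_cases i
    · rcases w with _ | ⟨b, w⟩
      · interval_cases j
        · exact ⟨e, 0, 1, [], by omega, by omega, by simp [cs]⟩
        · exact ⟨e + 1, 0, 0, [], by omega, by omega, by simp [pow_succ, c]⟩
      · cases b
        · exact ⟨e, 2, j, w, by omega, hj, by simp [pow_succ, c, mul_assoc]⟩
        · exact ⟨e, 1, j, w, by omega, hj, by simp [c, mul_assoc]⟩
    · exact ⟨e + 1, 0, j, true :: w, by omega, hj, by simp [pow_succ, c, mul_assoc]⟩
    · exact ⟨e + 1, 0, j, false :: w, by omega, hj, by simp [pow_succ, c, mul_assoc]⟩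
  have hs : s⁻¹ = s * s * s := by
    rw [inv_eq_iff_mul_eq_one, ← hz]; simp only [mul_assoc]
  have hu : (s * t)⁻¹ = s * s * (s * t * (s * t)) := by
    have h6 : (s * t) ^ 6 = 1 := by rw [pow_mul (s * t) 3 2, h3, pow_two, hz]
    rw [inv_eq_iff_mul_eq_one, ← h6, ← h3]
    simp only [pow_succ, pow_zero, one_mul, mul_assoc]
  suffices N g from this
  induction hg using Subgroup.closure_induction_left with
  | one => exact ⟨0, 0, 0, [], by omega, by omega, by simp⟩
  | mul_left x hx y _ ih =>
    rcases hx with rfl | rfl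
    · exact Ns _ ih
    · have : x * y = s * s * (s * (s * x * y)) := by
        have : x = s⁻¹ * (s * x) := by group
        nth_rewrite 1 [this]
        rw [hs]; simp only [mul_assoc]
      rw [this]
      exact Nz _ (Ns _ (Nu _ ih))
  | inv_mul_cancel x hx y _ ih =>
    rcases hx with rfl | rfl
    · rw [hs, mul_assoc]
      exact Nz _ (Ns _ ih)
    · have : x⁻¹ * y = s * s * (s * x * (s * x * (s * y))) := by
        have : x⁻¹ = (s * x)⁻¹ * s := by group
        rw [this, hu]; simp only [mul_assoc]
      rw [this]
      exact Nz _ (Nu _ (Nu _ (Ns _ ih)))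

theorem specialLinearGroup_two_mul_apply {R : Type*} [CommRing R] (A B : SL(2, R)) (i j : Fin 2) :
    (A * B) i j = A i 0 * B 0 j + A i 1 * B 1 j := by
  rw [Matrix.SpecialLinearGroup.coe_mul, Matrix.mul_apply, Fin.sum_univ_two]

/-- A word in the positive matrices `T` and `T * S * T`. -/
def positiveWord (w : List Bool) : SL(2, ℤ) :=
  (w.map fun b => if b then ModularGroup.T
    else ModularGroup.T * ModularGroup.S * ModularGroup.T).prod

theorem positiveWord_entries (w : List Bool) :
    1 ≤ positiveWord w 0 0 ∧ 0 ≤ positiveWord w 0 1 ∧ 0 ≤ positiveWord w 1 0 ∧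
    1 ≤ positiveWord w 1 1 ∧ (w.length : ℤ) ≤ positiveWord w 0 1 + positiveWord w 1 0 := by
  induction w with
  | nil => simp [positiveWord]
  | cons b w ih =>
    obtain ⟨h1, h2, h3, h4, h5⟩ := ih
    have : positiveWord (b :: w) = (if b then ModularGroup.T
      else ModularGroup.T * ModularGroup.S * ModularGroup.T) * positiveWord w := by
      simp [positiveWord]
    rw [this]
    cases b
    · simp [specialLinearGroup_two_mul_apply, ModularGroup.coe_S, ModularGroup.coe_T]
      omega
    · simp [specialLinearGroup_two_mul_apply, ModularGroup.coe_T]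
      omega

theorem S_mul_S : ModularGroup.S * ModularGroup.S = -1 := by
  ext a b
  fin_cases a <;> fin_cases b <;> simp [specialLinearGroup_two_mul_apply, ModularGroup.coe_S]

/-- The normal form of the identity matrix is trivial. -/
theorem normal_form_eq_one {e i j : ℕ} {w : List Bool} (hi : i < 3) (hj : j < 2)
    (h : (ModularGroup.S * ModularGroup.S) ^ e * (ModularGroup.S * ModularGroup.T) ^ i *
      positiveWord w * ModularGroup.S ^ j = 1) : Even e ∧ i = 0 ∧ j = 0 ∧ w = [] := by
  obtain ⟨h1, h2, h3, h4, h5⟩ := positiveWord_entries w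
  have hw : w = [] ↔ w.length = 0 := List.length_eq_zero_iff.symm
  have he : (e % 2 = 0 ∧ (ModularGroup.S * ModularGroup.S) ^ e = 1) ∨
      (e % 2 = 1 ∧ (ModularGroup.S * ModularGroup.S) ^ e = -1) := by
    rw [S_mul_S]
    rcases Nat.even_or_odd e with h | h
    · exact Or.inl ⟨Nat.even_iff.1 h, h.neg_one_pow⟩
    · exact Or.inr ⟨Nat.odd_iff.1 h, h.neg_one_pow⟩
  rw [hw, Nat.even_iff]
  have e00 := congrArg (fun M : SL(2, ℤ) => M 0 0) h
  have e01 := congrArg (fun M : SL(2, ℤ) => M 0 1) h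
  have e10 := congrArg (fun M : SL(2, ℤ) => M 1 0) h
  have e11 := congrArg (fun M : SL(2, ℤ) => M 1 1) h
  rcases he with ⟨he, he'⟩ | ⟨he, he'⟩ <;> rw [he'] at e00 e01 e10 e11 <;>
  interval_cases i <;> interval_cases j <;>
  simp [pow_succ, specialLinearGroup_two_mul_apply, ModularGroup.coe_S, ModularGroup.coe_T,
      Matrix.mul_apply, Matrix.vecMul, dotProduct, Fin.sum_univ_two]
    at e00 e01 e10 e11 <;> omega

end NormalForm

section InducedMatrix

local notation "F₂" => FreeGroup (Fin 2)

/-- The pairs of an automorphism of `F₂` and the matrix by which it acts on the abelianization. -/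
def inducing : Subgroup (MulAut F₂ × SL(2, ℤ)) where
  carrier := {p | Induces p.1 p.2}
  one_mem' := fun w => by simp
  mul_mem' := by
    rintro ⟨γ, M⟩ ⟨δ, N⟩ hγ hδ w
    simp only [Prod.mk_mul_mk]
    rw [MulAut.mul_apply, hγ, hδ, Matrix.mulVec_mulVec, Matrix.SpecialLinearGroup.coe_mul]
  inv_mem' := by
    rintro ⟨γ, M⟩ hγ w
    have h := hγ (γ⁻¹ w)
    simp only [MulAut.apply_inv_self] at h
    simp only [Prod.inv_mk]
    rw [h, Matrix.mulVec_mulVec, ← Matrix.SpecialLinearGroup.coe_mul, inv_mul_cancel]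
    simp

theorem Induces.mul {γ δ : MulAut F₂} {M N : SL(2, ℤ)} (hγ : Induces γ M) (hδ : Induces δ N) :
    Induces (γ * δ) (M * N) :=
  inducing.mul_mem (x := (γ, M)) (y := (δ, N)) hγ hδ

theorem Induces.inv {γ : MulAut F₂} {M : SL(2, ℤ)} (hγ : Induces γ M) : Induces γ⁻¹ M⁻¹ :=
  inducing.inv_mem (x := (γ, M)) hγ

theorem Induces.pow {γ : MulAut F₂} {M : SL(2, ℤ)} (hγ : Induces γ M) (n : ℕ) :
    Induces (γ ^ n) (M ^ n) :=
  inducing.pow_mem (x := (γ, M)) hγ n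

@[simp] theorem toAdd_exponentSum_of (i : Fin 2) :
    (exponentSum (FreeGroup.of i)).toAdd = Pi.single i 1 := by
  simp [exponentSum]

/-- The columns of the induced matrix are the exponent sums of the images of the generators. -/
theorem induces_iff {γ : MulAut F₂} {M : SL(2, ℤ)} : Induces γ M ↔ ∀ i j : Fin 2,
    (exponentSum (γ (FreeGroup.of j))).toAdd i = M i j := by
  constructor
  · intro h i j
    rw [h, toAdd_exponentSum_of]
    simp
  · intro h w
    induction w using FreeGroup.induction_on with
    | C1 => simp
    | of j =>
      rw [toAdd_exponentSum_of]
      ext i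
      simpa using h i j
    | inv_of j ih => simp only [map_inv, toAdd_inv, ih, Matrix.mulVec_neg]
    | mul u v hu hv => simp only [map_mul, toAdd_mul, hu, hv, Matrix.mulVec_add]

theorem Induces.unique {γ : MulAut F₂} {M N : SL(2, ℤ)} (hM : Induces γ M) (hN : Induces γ N) :
    M = N := by
  ext i j
  rw [← induces_iff.1 hM i j, ← induces_iff.1 hN i j]

theorem induces_conj (g : F₂) : Induces (MulAut.conj g) 1 := by
  intro w
  simp [MulAut.conj_apply]

theorem induces_autS : Induces autS ModularGroup.S := by
  rw [induces_iff]
  intro i j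
  fin_cases i <;> fin_cases j <;> simp [ModularGroup.coe_S]

theorem induces_autT (n : ℤ) : Induces (autT n) (ModularGroup.T ^ n) := by
  rw [induces_iff]
  intro i j
  rw [ModularGroup.coe_T_zpow]
  fin_cases i <;> fin_cases j <;> simp

theorem induces_autT_one : Induces (autT 1) ModularGroup.T := by simpa using induces_autT 1

theorem exists_induces_of_mem_nielsenPlus {γ : MulAut F₂} (hγ : γ ∈ nielsenPlus) :
    ∃ M, Induces γ M := by
  suffices h : nielsenPlus ≤ inducing.map (MonoidHom.fst _ _) by
    obtain ⟨⟨_, M⟩, hM, rfl⟩ := h hγ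
    exact ⟨M, hM⟩
  rw [nielsenPlus, sup_le_iff, Subgroup.closure_le]
  constructor
  · rintro _ (rfl | rfl)
    · exact ⟨(_, _), induces_autS, rfl⟩
    · exact ⟨(_, _), induces_autT_one, rfl⟩
  · rintro _ ⟨g, rfl⟩
    exact ⟨(_, _), induces_conj g, rfl⟩

/-- Every matrix in `SL₂(ℤ)` is induced by an automorphism of `F₂`. -/
theorem exists_induces (M : SL(2, ℤ)) : ∃ γ, Induces γ M := by
  suffices h : (⊤ : Subgroup SL(2, ℤ)) ≤ inducing.map (MonoidHom.snd _ _) by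
    obtain ⟨⟨γ, _⟩, hM, rfl⟩ := h (Subgroup.mem_top M)
    exact ⟨γ, hM⟩
  rw [← SpecialLinearGroup.SL2Z_generators, Subgroup.closure_le]
  rintro _ (rfl | rfl)
  · exact ⟨(_, _), induces_autS, rfl⟩
  · exact ⟨(_, _), induces_autT_one, rfl⟩

theorem conj_apply_eq (γ : MulAut F₂) (g : F₂) :
    γ * MulAut.conj g * γ⁻¹ = MulAut.conj (γ g) := by
  ext w
  simp [MulAut.conj_apply]

instance normal_range_conj : (MulAut.conj : F₂ →* MulAut F₂).range.Normal where
  conj_mem := by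
    rintro _ ⟨g, rfl⟩ γ
    exact ⟨γ g, (conj_apply_eq γ g).symm⟩

theorem autS_mul_autS_mul_self : autS * autS * (autS * autS) = 1 :=
  mulAut_ext_two (by simp) (by simp)

theorem autS_sq_mul_autT :
    autS * autS * autT 1 = MulAut.conj (FreeGroup.of 0)⁻¹ * (autT 1 * (autS * autS)) :=
  mulAut_ext_two (by simp) (by simp [mul_assoc])

theorem autS_mul_autT_pow_three : (autS * autT 1) ^ 3 =
    MulAut.conj (FreeGroup.of 1 * (FreeGroup.of 0)⁻¹) * (autS * autS) :=
  mulAut_ext_two (by simp [pow_succ, MulAut.conj_apply, mul_assoc])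
    (by simp [pow_succ, MulAut.conj_apply, mul_assoc])

theorem inner_of_mem_nielsenPlus {γ : MulAut F₂} (hγ : γ ∈ nielsenPlus) (h1 : Induces γ 1) :
    ∃ g, γ = MulAut.conj g := by
  let I := (MulAut.conj : F₂ →* MulAut F₂).range
  let q : MulAut F₂ →* MulAut F₂ ⧸ I := QuotientGroup.mk' I
  have hq : ∀ g : F₂, q (MulAut.conj g) = 1 := fun g =>
    (QuotientGroup.eq_one_iff _).2 ⟨g, rfl⟩
  have hmem : q γ ∈ Subgroup.closure {q autS, q (autT 1)} := by
    suffices h : nielsenPlus ≤ (Subgroup.closure {q autS, q (autT 1)}).comap q from h hγ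
    rw [nielsenPlus, sup_le_iff, Subgroup.closure_le]
    constructor
    · rintro _ (rfl | rfl)
      · exact Subgroup.subset_closure (by simp)
      · exact Subgroup.subset_closure (by simp)
    · rintro _ ⟨g, rfl⟩
      rw [Subgroup.mem_comap, hq]
      exact one_mem _
  obtain ⟨e, i, j, w, hi, hj, h⟩ := exists_normal_form
    (by simp only [← map_mul, autS_mul_autS_mul_self, map_one])
    (by rw [← map_mul, ← map_mul, autS_sq_mul_autT, map_mul, hq, one_mul, map_mul])
    (by rw [← map_mul, ← map_pow, autS_mul_autT_pow_three, map_mul, hq, one_mul, map_mul]) hmem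
  have hw : ∀ w : List Bool, ∃ δ, Induces δ (positiveWord w) ∧ (w.map fun b =>
      if b then q (autT 1) else q (autT 1) * q autS * q (autT 1)).prod = q δ := by
    intro w
    induction w with
    | nil => exact ⟨1, inducing.one_mem, by simp⟩
    | cons b w ih =>
      obtain ⟨δ, hδ, hδ'⟩ := ih
      cases b
      · refine ⟨autT 1 * autS * autT 1 * δ, ((induces_autT_one.mul induces_autS).mul induces_autT_one).mul hδ, ?_⟩
        simp [hδ']
      · exact ⟨autT 1 * δ, induces_autT_one.mul hδ, by simp [hδ']⟩
  obtain ⟨δ, hδ, hδ'⟩ := hw w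
  rw [hδ'] at h
  have hrep := ((((induces_autS.mul induces_autS).pow e).mul
    ((induces_autS.mul induces_autT_one).pow i)).mul hδ).mul (induces_autS.pow j)
  simp only [← map_mul, ← map_pow] at h
  obtain ⟨g, hg⟩ := QuotientGroup.eq.1 h
  have h2 := h1.inv.mul hrep
  rw [← hg] at h2
  have h3 := h2.unique (induces_conj g)
  rw [inv_one, one_mul] at h3
  obtain ⟨he, rfl, rfl, rfl⟩ := normal_form_eq_one hi hj h3
  obtain ⟨n, rfl⟩ := he
  have h4 : q δ = 1 := by rw [← hδ']; simp
  have h5 : (autS * autS) ^ (n + n) = 1 := by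
    rw [← two_mul, pow_mul, pow_two, autS_mul_autS_mul_self, one_pow]
  rw [h5, map_mul, map_mul, map_mul, h4] at h
  obtain ⟨g, hg⟩ := (QuotientGroup.eq_one_iff γ).1 (show q γ = 1 by simpa using h)
  exact ⟨g, hg.symm⟩

theorem autR_conj_mem_nielsenPlus {γ : MulAut F₂} (hγ : γ ∈ nielsenPlus) :
    autR * γ * autR ∈ nielsenPlus := by
  have hR : autR * autR = 1 := mulAut_ext_two (by simp) (by simp)
  have hR' : autR⁻¹ = autR := inv_eq_of_mul_eq_one_left hR
  suffices h : nielsenPlus ≤ nielsenPlus.comap (MulAut.conj autR).toMonoidHom by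
    have := h hγ
    simpa [MulAut.conj_apply, hR'] using this
  rw [nielsenPlus, sup_le_iff, Subgroup.closure_le, ← nielsenPlus]
  constructor
  · rintro _ (rfl | rfl)
    · have : autR * autS * autR = autS⁻¹ := by
        rw [eq_inv_iff_mul_eq_one]
        exact mulAut_ext_two (by simp) (by simp)
      simpa [MulAut.conj_apply, hR', this] using autS_mem_nielsenPlus
    · have : autR * autT 1 * autR = (autT 1)⁻¹ := by
        rw [eq_inv_iff_mul_eq_one]
        exact mulAut_ext_two (by simp) (by simp)
      simpa [MulAut.conj_apply, hR', this] using autT_mem_nielsenPlus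
  · rintro _ ⟨g, rfl⟩
    have : autR * MulAut.conj g * autR⁻¹ ∈ nielsenPlus := by
      rw [conj_apply_eq]
      exact conj_mem_nielsenPlus _
    simpa [MulAut.conj_apply] using this

theorem mem_nielsenPlus_or (γ : MulAut F₂) : γ ∈ nielsenPlus ∨ autR * γ ∈ nielsenPlus := by
  have hR : autR * autR = 1 := mulAut_ext_two (by simp) (by simp)
  have hR' : autR⁻¹ = autR := inv_eq_of_mul_eq_one_left hR
  have hγ : γ ∈ nielsen := by rw [nielsen_eq_top]; trivial
  have hcl : nielsen = Subgroup.closure ((nielsenPlus : Set (MulAut F₂)) ∪ {autR}) := by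
    rw [Subgroup.closure_union, Subgroup.closure_eq, ← Subgroup.zpowers_eq_closure, nielsen]
  rw [hcl] at hγ
  have step : ∀ y, (y ∈ nielsenPlus ∨ autR * y ∈ nielsenPlus) →
      (autR * y ∈ nielsenPlus ∨ autR * (autR * y) ∈ nielsenPlus) := by
    rintro y (h | h)
    · right; rwa [← mul_assoc, hR, one_mul]
    · exact Or.inl h
  have step' : ∀ x ∈ nielsenPlus, ∀ y, (y ∈ nielsenPlus ∨ autR * y ∈ nielsenPlus) →
      (x * y ∈ nielsenPlus ∨ autR * (x * y) ∈ nielsenPlus) := by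
    rintro x hx y (h | h)
    · exact Or.inl (mul_mem hx h)
    · right
      have := mul_mem (autR_conj_mem_nielsenPlus hx) h
      rwa [← mul_assoc, mul_assoc _ autR autR, hR, mul_one, mul_assoc] at this
  induction hγ using Subgroup.closure_induction_left with
  | one => exact Or.inl (one_mem _)
  | mul_left x hx y _ ih =>
    rcases hx with hx | rfl
    · exact step' x hx y ih
    · exact step y ih
  | inv_mul_cancel x hx y _ ih =>
    rcases hx with hx | rfl
    · exact step' x⁻¹ (inv_mem hx) y ih
    · rw [hR']; exact step y ih

/-- **Nielsen's theorem**: an automorphism of `F₂` acting trivially on the abelianization is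
inner. -/
theorem inner_of_induces_one {γ : MulAut F₂} (h : Induces γ 1) : ∃ g, γ = MulAut.conj g := by
  rcases mem_nielsenPlus_or γ with hγ | hγ
  · exact inner_of_mem_nielsenPlus hγ h
  · -- The action of `autR * γ` on `ℤ²` would have determinant `-1`.
    exfalso
    obtain ⟨M, hM⟩ := exists_induces_of_mem_nielsenPlus hγ
    have hM' : Induces γ⁻¹ 1 := by simpa using h.inv
    have hcol : ∀ j, (exponentSum (autR (FreeGroup.of j))).toAdd =
        (M : Matrix (Fin 2) (Fin 2) ℤ).mulVec (Pi.single j 1) := by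
      intro j
      have h1 := hM (γ⁻¹ (FreeGroup.of j))
      rw [MulAut.mul_apply, MulAut.apply_inv_self, hM', Matrix.SpecialLinearGroup.coe_one,
        Matrix.one_mulVec, toAdd_exponentSum_of] at h1
      exact h1
    have h0 := hcol 0
    have h1 := hcol 1
    have hdet := M.det_coe
    rw [Matrix.det_fin_two] at hdet
    have a := congrFun h0 0
    have b := congrFun h0 1
    have c := congrFun h1 0
    have d := congrFun h1 1
    simp at a b c d
    rw [← a, ← b, ← c, ← d] at hdet
    norm_num at hdet

theorem Induces.exists_eq_conj_mul {γ δ : MulAut F₂} {M : SL(2, ℤ)} (hγ : Induces γ M)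
    (hδ : Induces δ M) : ∃ g, γ = MulAut.conj g * δ := by
  obtain ⟨g, hg⟩ := inner_of_induces_one (γ := γ * δ⁻¹) (by simpa using hγ.mul hδ.inv)
  exact ⟨g, by rw [← hg, inv_mul_cancel_right]⟩

end InducedMatrix

/-! ### Generation of `SL₂` over a finite ring by unipotent elements -/

section Unipotent

variable {R : Type*} [CommRing R]

/-- The unipotent matrix `T ^ r`, fixing the vector `(1, 0)`. -/
def unipT (r : R) : SL(2, R) := ⟨!![1, r; 0, 1], by simp⟩

/-- The unipotent matrix `L ^ r`, fixing the vector `(0, 1)`. -/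
def unipL (r : R) : SL(2, R) := ⟨!![1, 0; r, 1], by simp⟩

/-- The unipotent matrix `U ^ r`, fixing the vector `(1, 1)`. -/
def unipU (r : R) : SL(2, R) := ⟨!![1 + r, -r; r, 1 - r], by simp [Matrix.det_fin_two]; ring⟩

theorem coe_unipT (r : R) : (unipT r : Matrix (Fin 2) (Fin 2) R) = !![1, r; 0, 1] := rfl

theorem coe_unipL (r : R) : (unipL r : Matrix (Fin 2) (Fin 2) R) = !![1, 0; r, 1] := rfl

theorem coe_unipU (r : R) : (unipU r : Matrix (Fin 2) (Fin 2) R) = !![1 + r, -r; r, 1 - r] := rfl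

theorem specialLinearGroup_two_ext {A B : SL(2, R)} (h00 : A 0 0 = B 0 0) (h01 : A 0 1 = B 0 1)
    (h10 : A 1 0 = B 1 0) (h11 : A 1 1 = B 1 1) : A = B := by
  ext i j
  fin_cases i <;> fin_cases j
  exacts [h00, h01, h10, h11]

theorem unipT_mul (r s : R) : unipT r * unipT s = unipT (r + s) := by
  apply specialLinearGroup_two_ext <;>
    simp [specialLinearGroup_two_mul_apply, coe_unipT, add_comm]

theorem unipL_mul (r s : R) : unipL r * unipL s = unipL (r + s) := by
  apply specialLinearGroup_two_ext <;>
    simp [specialLinearGroup_two_mul_apply, coe_unipL]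

/-- An idempotent cuts the conjugacy `L⁻¹ * U * L = T⁻¹` down to a factor of the ring. -/
theorem unipT_mul_idempotent (r : R) {f : R} (hf : f * f = f) :
    unipT (r * f) = unipL (-f) * unipU (-(r * f)) * unipL f := by
  apply specialLinearGroup_two_ext <;>
    simp [specialLinearGroup_two_mul_apply, coe_unipL, coe_unipU, coe_unipT]
  · linear_combination (-r) * hf
  · linear_combination (-r + r * f) * hf
  · linear_combination r * hf

/-- An idempotent cuts the conjugacy `T⁻¹ * U * T = L` down to a factor of the ring. -/
theorem unipL_mul_idempotent (r : R) {f : R} (hf : f * f = f) :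
    unipL (r * f) = unipT (-f) * unipU (r * f) * unipT f := by
  apply specialLinearGroup_two_ext <;>
    simp [specialLinearGroup_two_mul_apply, coe_unipL, coe_unipU, coe_unipT]
  · linear_combination r * hf
  · linear_combination (-r + r * f) * hf
  · linear_combination (-r) * hf

theorem exists_pow_idempotent [Finite R] (a : R) : ∃ k ≠ 0, a ^ k * a ^ k = a ^ k := by
  obtain ⟨m, n, hmn, h⟩ := Finite.exists_ne_map_eq_of_infinite fun n : ℕ => a ^ n
  wlog hlt : m < n generalizing m n
  · exact this n m hmn.symm h.symm (by omega)
  obtain ⟨d, rfl⟩ := Nat.exists_eq_add_of_le hlt.le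
  have h1 : ∀ i j : ℕ, m ≤ i → a ^ (i + j * d) = a ^ i := by
    intro i j hi
    induction j with
    | zero => simp
    | succ j ih =>
      obtain ⟨i, rfl⟩ := Nat.exists_eq_add_of_le hi
      have : m + i + (j + 1) * d = (m + d) + (i + j * d) := by ring
      rw [this, pow_add, ← h, ← pow_add, ← ih, add_assoc]
  have hd : 1 ≤ d := by omega
  refine ⟨(m + 1) * d, by positivity, ?_⟩
  rw [← pow_add, h1 _ _ (by nlinarith)]

/-- For coprime `A` and `B`, the projection to the part of a finite ring where `A` is nilpotent is
divisible by `B`. -/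
theorem exists_idempotent_of_coprime [Finite R] {A B : ℕ} (h : A.Coprime B) :
    ∃ f : R, f * f = f ∧ (∃ u, f = B * u) ∧ ∃ u, 1 - f = A * u := by
  obtain ⟨k, hk, he⟩ := exists_pow_idempotent (A : R)
  have hc : IsCoprime ((A : R) ^ k) (B : R) := by
    have := (Nat.isCoprime_iff_coprime.2 h).map (Int.castRingHom R)
    simp only [map_natCast] at this
    exact this.pow_left
  obtain ⟨x, y, hxy⟩ := hc
  refine ⟨1 - (A : R) ^ k, by linear_combination he, ⟨(1 - (A : R) ^ k) * y, ?_⟩,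
    ⟨(A : R) ^ (k - 1), ?_⟩⟩
  · linear_combination (-(1 - (A : R) ^ k)) * hxy + (-x) * he
  · rw [sub_sub_cancel, mul_pow_sub_one hk]

/-- Finite rings have stable range one. -/
theorem exists_isUnit_add_mul [Finite R] {a c : R} (h : IsCoprime a c) :
    ∃ t, IsUnit (a + t * c) := by
  obtain ⟨x, y, hxy⟩ := h
  obtain ⟨k, hk, he⟩ := exists_pow_idempotent a
  refine ⟨(1 - a ^ k) * y, ?_⟩
  by_contra hu
  obtain ⟨m, hm, hmem⟩ := exists_max_ideal_of_mem_nonunits hu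
  have hk' : a ^ k = a * a ^ (k - 1) := (mul_pow_sub_one hk a).symm
  by_cases ha : a ∈ m
  · refine hm.ne_top ((Ideal.eq_top_iff_one m).2 ?_)
    have h1 : (1 : R) = (a + (1 - a ^ k) * y * c) + a * (x - 1 + a ^ (k - 1) * y * c) := by
      linear_combination (-1 : R) * hxy + y * c * hk'
    rw [h1]
    exact m.add_mem hmem (m.mul_mem_right _ ha)
  · have h1 : a ^ k * (1 - a ^ k) ∈ m := by
      have : a ^ k * (1 - a ^ k) = 0 := by linear_combination -he
      rw [this]
      exact m.zero_mem
    have h2 : 1 - a ^ k ∈ m := (hm.isPrime.mem_or_mem h1).resolve_left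
      fun h3 => ha (hm.isPrime.mem_of_pow_mem _ h3)
    apply ha
    have h3 : a = (a + (1 - a ^ k) * y * c) - (1 - a ^ k) * (y * c) := by ring
    rw [h3]
    exact m.sub_mem hmem (m.mul_mem_right _ h2)

/-- Over a finite ring, `SL₂` is generated by elementary matrices. -/
theorem eq_top_of_elementary_mem [Finite R] {H : Subgroup SL(2, R)} (hT : ∀ r, unipT r ∈ H)
    (hL : ∀ r, unipL r ∈ H) : H = ⊤ := by
  rw [eq_top_iff]
  intro M _
  have hdet := M.det_coe
  rw [Matrix.det_fin_two] at hdet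
  obtain ⟨t, ht⟩ := exists_isUnit_add_mul (a := M 0 0) (c := M 1 0)
    ⟨M 1 1, -M 0 1, by linear_combination hdet⟩
  obtain ⟨v, hv⟩ := ht.exists_left_inv
  -- The column `(a, c)` becomes successively `(u, c)` with `u` a unit, `(u, 1)`, `(1, 1)`, `(1, 0)`.
  set E := unipL (-1) * unipT (1 - (M 0 0 + t * M 1 0)) * unipL ((1 - M 1 0) * v) * unipT t
  have hE : E ∈ H := mul_mem (mul_mem (mul_mem (hL _) (hT _)) (hL _)) (hT _)
  have hcol : (E * M) 0 0 = 1 ∧ (E * M) 1 0 = 0 := by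
    constructor
    · simp [E, specialLinearGroup_two_mul_apply, coe_unipL, coe_unipT]
      linear_combination ((1 - (M 0 0 + t * M 1 0)) * (1 - M 1 0)) * hv
    · simp [E, specialLinearGroup_two_mul_apply, coe_unipL, coe_unipT]
      linear_combination ((M 0 0 + t * M 1 0) * (1 - M 1 0)) * hv
  have hdet' := (E * M).det_coe
  rw [Matrix.det_fin_two, hcol.1, hcol.2] at hdet'
  have h1 : E * M = unipT ((E * M) 0 1) :=
    specialLinearGroup_two_ext hcol.1 rfl hcol.2
      (by simpa [coe_unipT] using hdet')
  rw [← H.mul_mem_cancel_left hE, h1]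
  exact hT _

/-- If `A`, `B`, `C` are pairwise coprime, then over every local factor of a finite ring at least two
of the three one-parameter unipotent groups are full, and any two of them generate `SL₂`. -/
theorem eq_top_of_coprime_unipotent_mem [Finite R] {A B C : ℕ} (hAB : A.Coprime B)
    (hAC : A.Coprime C) (hBC : B.Coprime C) {H : Subgroup SL(2, R)}
    (hT : ∀ r : R, unipT (A * r) ∈ H) (hL : ∀ r : R, unipL (B * r) ∈ H)
    (hU : ∀ r : R, unipU (C * r) ∈ H) : H = ⊤ := by
  apply eq_top_of_elementary_mem
  · intro r
    obtain ⟨f, hf, ⟨u, hu⟩, ⟨v, hv⟩⟩ :=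
      exists_idempotent_of_coprime (R := R) (Nat.Coprime.mul_right hAB hAC)
    push_cast at hu
    have h1 : r = A * (r * v) + r * f := by linear_combination r * hv
    have hl : ∀ s : R, unipL (s * f) ∈ H := fun s => by
      rw [show s * f = B * (s * (C * u)) by linear_combination s * hu]; exact hL _
    have hu' : ∀ s : R, unipU (s * f) ∈ H := fun s => by
      rw [show s * f = C * (s * (B * u)) by linear_combination s * hu]; exact hU _
    rw [h1, ← unipT_mul, unipT_mul_idempotent r hf]
    refine mul_mem (hT _) (mul_mem (mul_mem ?_ ?_) ?_)
    · simpa using hl (-1)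
    · simpa using hu' (-r)
    · simpa using hl 1
  · intro r
    obtain ⟨f, hf, ⟨u, hu⟩, ⟨v, hv⟩⟩ :=
      exists_idempotent_of_coprime (R := R) (Nat.Coprime.mul_right hAB.symm hBC)
    push_cast at hu
    have h1 : r = B * (r * v) + r * f := by linear_combination r * hv
    have ht : ∀ s : R, unipT (s * f) ∈ H := fun s => by
      rw [show s * f = A * (s * (C * u)) by linear_combination s * hu]; exact hT _
    have hu' : ∀ s : R, unipU (s * f) ∈ H := fun s => by
      rw [show s * f = C * (s * (A * u)) by linear_combination s * hu]; exact hU _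
    rw [h1, ← unipL_mul, unipL_mul_idempotent r hf]
    refine mul_mem (hL _) (mul_mem (mul_mem ?_ (hu' r)) ?_)
    · simpa using ht (-1)
    · simpa using ht 1

end Unipotent

/-! ### Subgroups of `SL₂(ℤ)` surjecting onto `SL₂(ℤ/l)` -/

section Reduction

theorem reduction_unipT (l : ℕ) (n : ℤ) : reduction l (unipT n) = unipT (n : ZMod l) := by
  apply specialLinearGroup_two_ext <;> simp [reduction, coe_unipT]

theorem reduction_unipL (l : ℕ) (n : ℤ) : reduction l (unipL n) = unipL (n : ZMod l) := by
  apply specialLinearGroup_two_ext <;> simp [reduction, coe_unipL]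

theorem reduction_unipU (l : ℕ) (n : ℤ) : reduction l (unipU n) = unipU (n : ZMod l) := by
  apply specialLinearGroup_two_ext <;> simp [reduction, coe_unipU]

theorem map_reduction_eq_top {A B C : ℕ} (hAB : A.Coprime B) (hAC : A.Coprime C)
    (hBC : B.Coprime C) {Γ : Subgroup SL(2, ℤ)} (hT : ∀ n : ℤ, unipT (A * n) ∈ Γ)
    (hL : ∀ n : ℤ, unipL (B * n) ∈ Γ) (hU : ∀ n : ℤ, unipU (C * n) ∈ Γ) {l : ℕ} (hl : l ≠ 0) :
    Γ.map (reduction l) = ⊤ := by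
  have : NeZero l := ⟨hl⟩
  refine eq_top_of_coprime_unipotent_mem hAB hAC hBC (fun r => ?_) (fun r => ?_) (fun r => ?_) <;>
    obtain ⟨n, rfl⟩ := ZMod.intCast_surjective r
  · exact ⟨_, hT n, by rw [reduction_unipT]; simp⟩
  · exact ⟨_, hL n, by rw [reduction_unipL]; simp⟩
  · exact ⟨_, hU n, by rw [reduction_unipU]; simp⟩

theorem reduction_surjective {l : ℕ} (hl : l ≠ 0) : Function.Surjective (reduction l) := by
  rw [← MonoidHom.range_eq_top, MonoidHom.range_eq_map]
  exact map_reduction_eq_top (A := 1) (B := 1) (C := 1) (by simp) (by simp) (by simp)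
    (fun _ => Subgroup.mem_top _) (fun _ => Subgroup.mem_top _) (fun _ => Subgroup.mem_top _) hl

end Reduction

/-! ### Stabilizers of exterior homomorphisms -/

section Stabilizer

local notation "F₂" => FreeGroup (Fin 2)

variable {G : Type*} [Group G]

/-- The lift `x ↦ x * y ^ n`, `y ↦ y` of `L ^ n`. -/
def autL (n : ℤ) : MulAut F₂ :=
  autOf (.of 0 * .of 1 ^ n) (.of 1) (.of 0 * .of 1 ^ (-n)) (.of 1)
    (by simp) (by simp) (by simp) (by simp)

/-- The lift `x ↦ x * (x * y) ^ n`, `y ↦ (x * y) ^ (-n) * y` of `U ^ n`, which fixes `x * y`. -/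
def autU (n : ℤ) : MulAut F₂ :=
  autOf (.of 0 * (.of 0 * .of 1) ^ n) ((.of 0 * .of 1) ^ (-n) * .of 1)
    (.of 0 * (.of 0 * .of 1) ^ (-n)) ((.of 0 * .of 1) ^ n * .of 1)
    (by simp [mul_assoc]) (by simp [mul_assoc]) (by simp [mul_assoc]) (by simp [mul_assoc])

theorem autL_of_zero (n : ℤ) : autL n (FreeGroup.of 0) = .of 0 * .of 1 ^ n := by
  simp [autL, autOf]

theorem autL_of_one (n : ℤ) : autL n (FreeGroup.of 1) = .of 1 := by simp [autL, autOf]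

theorem autU_of_zero (n : ℤ) :
    autU n (FreeGroup.of 0) = .of 0 * (.of 0 * .of 1) ^ n := by simp [autU, autOf]

theorem autU_of_one (n : ℤ) :
    autU n (FreeGroup.of 1) = (.of 0 * .of 1) ^ (-n) * .of 1 := by simp [autU, autOf]

theorem induces_autT_unipT (n : ℤ) : Induces (autT n) (unipT n) := by
  rw [induces_iff]
  intro i j
  fin_cases i <;> fin_cases j <;> simp [coe_unipT]

theorem induces_autL (n : ℤ) : Induces (autL n) (unipL n) := by
  rw [induces_iff]
  intro i j
  fin_cases i <;> fin_cases j <;> simp [coe_unipL, autL_of_zero, autL_of_one]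

theorem induces_autU (n : ℤ) : Induces (autU n) (unipU n) := by
  rw [induces_iff]
  intro i j
  fin_cases i <;> fin_cases j <;> simp [coe_unipU, autU_of_zero, autU_of_one]
  ring

theorem mem_stabilizer_of_comp_eq {φ : F₂ →* G} {γ : MulAut F₂} {M : SL(2, ℤ)}
    (hγ : Induces γ M) (h0 : φ (γ (.of 0)) = φ (.of 0)) (h1 : φ (γ (.of 1)) = φ (.of 1)) :
    M ∈ stabilizer φ := by
  refine ⟨γ, hγ, 1, fun w => ?_⟩
  have : φ.comp γ.toMonoidHom = φ := monoidHom_ext_two h0 h1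
  rw [this, one_mul, inv_one, mul_one]

theorem pow_orderOf_mul_eq_one (g : G) (n : ℤ) : g ^ ((orderOf g : ℤ) * n) = 1 := by
  rw [zpow_mul, zpow_natCast, pow_orderOf_eq_one, one_zpow]

theorem unipT_mem_stabilizer (φ : F₂ →* G) (n : ℤ) :
    unipT ((orderOf (φ (.of 0)) : ℤ) * n) ∈ stabilizer φ :=
  mem_stabilizer_of_comp_eq (induces_autT_unipT _) (by simp)
    (by simp [pow_orderOf_mul_eq_one])

theorem unipL_mem_stabilizer (φ : F₂ →* G) (n : ℤ) :
    unipL ((orderOf (φ (.of 1)) : ℤ) * n) ∈ stabilizer φ :=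
  mem_stabilizer_of_comp_eq (induces_autL _) (by simp [autL_of_zero, pow_orderOf_mul_eq_one])
    (by simp [autL_of_one])

theorem unipU_mem_stabilizer (φ : F₂ →* G) (n : ℤ) :
    unipU ((orderOf (φ (.of 0) * φ (.of 1)) : ℤ) * n) ∈ stabilizer φ :=
  mem_stabilizer_of_comp_eq (induces_autU _)
    (by simp [autU_of_zero, pow_orderOf_mul_eq_one])
    (by simp [autU_of_one, pow_orderOf_mul_eq_one])

/-- `SL₂(ℤ)` acts on the finite set of homomorphisms `F₂ → G` modulo `Inn(G)`. -/
theorem finiteIndex_stabilizer [Finite G] (φ : F₂ →* G) : (stabilizer φ).FiniteIndex := by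
  choose γ hγ using exists_induces
  have : Finite (F₂ →* G) := Finite.of_equiv (Fin 2 → G) FreeGroup.lift
  have hinj : Function.Injective fun c : SL(2, ℤ) ⧸ stabilizer φ =>
      φ.comp (γ c.out)⁻¹.toMonoidHom := by
    intro c d h
    rw [← c.out_eq', ← d.out_eq']
    refine QuotientGroup.eq.2 ⟨(γ c.out)⁻¹ * γ d.out, (hγ _).inv.mul (hγ _), 1, fun w => ?_⟩
    have h1 := DFunLike.congr_fun h (γ d.out w)
    simp at h1
    simp [h1]
  have := Finite.of_injective _ hinj
  exact Subgroup.finiteIndex_of_finite_quotient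

theorem mem_pm {Γ : Subgroup SL(2, ℤ)} {M : SL(2, ℤ)} : M ∈ pm Γ ↔ M ∈ Γ ∨ -M ∈ Γ := by
  constructor
  · intro h
    have hN : (Subgroup.zpowers (-1 : SL(2, ℤ))).Normal := by
      refine ⟨fun n hn g => ?_⟩
      obtain ⟨k, rfl⟩ := Subgroup.mem_zpowers_iff.1 hn
      have : Commute g ((-1) ^ k) := (Commute.neg_one_right g).zpow_right k
      rw [this.eq, mul_inv_cancel_right]
      exact hn
    rw [pm, ← SetLike.mem_coe, Subgroup.mul_normal] at h
    obtain ⟨A, hA, B, hB, rfl⟩ := h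
    obtain ⟨k, rfl⟩ := Subgroup.mem_zpowers_iff.1 hB
    rcases Int.even_or_odd k with hk | hk
    · left; simpa [hk.neg_one_zpow] using hA
    · right; simpa [hk.neg_one_zpow] using hA
  · rintro (h | h)
    · exact Subgroup.mem_sup_left h
    · have h1 : (-M) * (-1) ∈ pm Γ :=
        mul_mem (Subgroup.mem_sup_left h) (Subgroup.mem_sup_right (Subgroup.mem_zpowers _))
      simpa using h1

/-- An automorphism inducing `±S` sends `x` to a conjugate of `y` or `y⁻¹`, so it can only fix the
class of `φ` if `φ x` and `φ y` have the same order. -/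
theorem orderOf_eq_of_S_mem_pm {φ : F₂ →* G} (h : ModularGroup.S ∈ pm (stabilizer φ)) :
    orderOf (φ (.of 0)) = orderOf (φ (.of 1)) := by
  have hconj : ∀ (a g : G), orderOf (g * a * g⁻¹) = orderOf a := fun a g =>
    (MulAut.conj g).orderOf_eq a
  have key : ∀ {γ δ : MulAut F₂} {M : SL(2, ℤ)}, Induces γ M → Induces δ M →
      ExtEquiv φ (φ.comp γ.toMonoidHom) → orderOf (φ (.of 0)) = orderOf (φ (δ (.of 0))) := by
    intro γ δ M hγ hδ ⟨g, hg⟩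
    obtain ⟨k, rfl⟩ := hγ.exists_eq_conj_mul hδ
    have h1 := hg (.of 0)
    simp [MulAut.conj_apply] at h1
    have h2 := congrArg orderOf h1
    rw [hconj, hconj] at h2
    exact h2.symm
  rcases mem_pm.1 h with ⟨γ, hγ, hφ⟩ | ⟨γ, hγ, hφ⟩
  · simpa using key hγ induces_autS hφ
  · have h3 := (induces_autS.mul induces_autS).mul induces_autS
    rw [S_mul_S, neg_one_mul] at h3
    simpa using key hγ h3 hφ

/-- Cusp widths are at most the index of the normal core of `±Γ`, hence divide its factorial. -/
theorem exists_cuspWidth_dvd (Γ : Subgroup SL(2, ℤ)) [Γ.FiniteIndex] :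
    ∃ l : ℕ, 1 ≤ l ∧ ∀ M : SL(2, ℤ), cuspWidth Γ M ∣ l := by
  have : (pm Γ).FiniteIndex := Subgroup.finiteIndex_of_le (H := Γ) le_sup_left
  set n := (pm Γ).normalCore.index
  have hn : 1 ≤ n := Nat.one_le_iff_ne_zero.2 Subgroup.FiniteIndex.index_ne_zero
  refine ⟨n.factorial, Nat.factorial_pos n, fun M => ?_⟩
  have hmem : n ∈ {n : ℕ | 1 ≤ n ∧ M * ModularGroup.T ^ n * M⁻¹ ∈ pm Γ} := by
    refine ⟨hn, ?_⟩
    rw [← conj_pow]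
    exact (pm Γ).normalCore_le (Subgroup.pow_index_mem _ _)
  exact Nat.dvd_factorial (Nat.sInf_mem ⟨n, hmem⟩).1 (Nat.sInf_le hmem)

/-- For finite index, the infimum defining the geometric level is not the junk value `0` of an empty
set, so reduction modulo the level has a finite target. -/
theorem geometricLevel_ne_zero (Γ : Subgroup SL(2, ℤ)) [Γ.FiniteIndex] : geometricLevel Γ ≠ 0 :=
  Nat.one_le_iff_ne_zero.1 (Nat.sInf_mem (exists_cuspWidth_dvd Γ)).1

theorem isNoncongruenceSubgroup_of_map_reduction_eq_top {Γ : Subgroup SL(2, ℤ)} [Γ.FiniteIndex]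
    (hΓ : Γ ≠ ⊤) (h : ∀ l ≠ 0, Γ.map (reduction l) = ⊤) : IsNoncongruenceSubgroup Γ := by
  refine ⟨inferInstance, fun ⟨N, hN, hle⟩ => hΓ ?_⟩
  have hker : (reduction N).ker ≤ Γ := hle
  rw [← sup_eq_left.2 hker, ← Subgroup.comap_map_eq, h N hN, Subgroup.comap_top]

theorem isTotallyNoncongruence_of_map_reduction_eq_top {Γ : Subgroup SL(2, ℤ)} [Γ.FiniteIndex]
    (hΓ : pm Γ ≠ ⊤) (h : ∀ l ≠ 0, Γ.map (reduction l) = ⊤) : IsTotallyNoncongruence Γ := by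
  have : (pm Γ).FiniteIndex := Subgroup.finiteIndex_of_le (H := Γ) le_sup_left
  refine ⟨inferInstance, ?_, ?_⟩
  · rw [Subgroup.index_eq_one, eq_top_iff, ← h _ (geometricLevel_ne_zero Γ)]
    exact Subgroup.map_mono le_sup_left
  · exact (Subgroup.one_lt_index_of_ne_top hΓ)

theorem totallyNoncongruence_of_coprime_orders [Finite G] [Nontrivial G] {a b : G}
    (hgen : Subgroup.closure {a, b} = ⊤) (hab : (orderOf a).Coprime (orderOf b))
    (hac : (orderOf a).Coprime (orderOf (a * b))) (hbc : (orderOf b).Coprime (orderOf (a * b)))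
    {φ : F₂ →* G} (ha : φ (.of 0) = a) (hb : φ (.of 1) = b) :
    IsTotallyNoncongruence (stabilizer φ) ∧ IsNoncongruenceSubgroup (stabilizer φ) := by
  have := finiteIndex_stabilizer φ
  have hpm : pm (stabilizer φ) ≠ ⊤ := by
    intro h
    have h1 := orderOf_eq_of_S_mem_pm (φ := φ) (h ▸ Subgroup.mem_top _)
    rw [ha, hb] at h1
    rw [h1, Nat.coprime_self, orderOf_eq_one_iff] at hab
    rw [hab, orderOf_one, orderOf_eq_one_iff] at h1
    rw [hab, h1] at hgen
    exact bot_ne_top ((by simp : Subgroup.closure {1, 1} = (⊥ : Subgroup G)).symm.trans hgen)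
  have hred : ∀ l ≠ 0, (stabilizer φ).map (reduction l) = ⊤ := by
    subst ha hb
    intro l hl
    exact map_reduction_eq_top hab hac hbc (unipT_mem_stabilizer φ) (unipL_mem_stabilizer φ)
      (unipU_mem_stabilizer φ) hl
  exact ⟨isTotallyNoncongruence_of_map_reduction_eq_top hpm hred,
    isNoncongruenceSubgroup_of_map_reduction_eq_top
      (fun h => hpm (eq_top_iff.2 (h ▸ le_sup_left))) hred⟩

end Stabilizer

/-! ### Projective special linear groups over prime fields -/

theorem S_mul_T_pow_three : (ModularGroup.S * ModularGroup.T) ^ 3 = -1 := by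
  ext a b
  fin_cases a <;> fin_cases b <;>
    simp [pow_succ, specialLinearGroup_two_mul_apply, ModularGroup.coe_S, ModularGroup.coe_T]

/-- The images of `S` and `S * T` in `PSL₂(𝔽_p)` generate it; they have orders `2` and `3`, and
their product, the image of `-T`, has order `p`. -/
theorem isNoncongruenceGroup_projectiveSpecialLinearGroup {p : ℕ} (hp : p.Prime) (h5 : 5 ≤ p) :
    IsNoncongruenceGroup (Matrix.ProjectiveSpecialLinearGroup (Fin 2) (ZMod p)) := by
  have : Fact p.Prime := ⟨hp⟩
  let π : SL(2, ZMod p) →* Matrix.ProjectiveSpecialLinearGroup (Fin 2) (ZMod p) :=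
    QuotientGroup.mk' _
  have hπ : Function.Surjective π := QuotientGroup.mk'_surjective _
  let q := π.comp (reduction p)
  have hq : Function.Surjective q := hπ.comp (reduction_surjective hp.ne_zero)
  have hfin : Finite (Matrix.ProjectiveSpecialLinearGroup (Fin 2) (ZMod p)) :=
    Finite.of_surjective _ hπ
  have hneg : q (-1) = 1 := by
    refine (QuotientGroup.eq_one_iff _).2 (Subgroup.mem_center_iff.2 fun g => ?_)
    have : reduction p (-1) = -1 := by
      apply specialLinearGroup_two_ext <;> simp [reduction]
    rw [this]
    exact (Commute.neg_one_right g).eq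
  have hST : q ModularGroup.S * q (ModularGroup.S * ModularGroup.T) = q ModularGroup.T := by
    rw [← map_mul, ← mul_assoc, S_mul_S, map_mul, hneg, one_mul]
  have hgen : Subgroup.closure {q ModularGroup.S, q (ModularGroup.S * ModularGroup.T)} = ⊤ := by
    rw [eq_top_iff, ← MonoidHom.range_eq_top.2 hq, MonoidHom.range_eq_map,
      ← SpecialLinearGroup.SL2Z_generators, MonoidHom.map_closure, Subgroup.closure_le]
    rintro _ ⟨_, rfl | rfl, rfl⟩
    · exact Subgroup.subset_closure (Set.mem_insert _ _)
    · change q ModularGroup.T ∈ _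
      rw [← hST]
      exact mul_mem (Subgroup.subset_closure (Set.mem_insert _ _))
        (Subgroup.subset_closure (Set.mem_insert_of_mem _ rfl))
  have hT : q ModularGroup.T ≠ 1 := by
    intro h
    have h1 := Subgroup.mem_center_iff.1 ((QuotientGroup.eq_one_iff _).1 h) (unipL 1)
    have h2 := congrArg (fun M : SL(2, ZMod p) => M 0 0) h1
    simp [specialLinearGroup_two_mul_apply, reduction, coe_unipL, ModularGroup.coe_T] at h2
  have : Nontrivial (Matrix.ProjectiveSpecialLinearGroup (Fin 2) (ZMod p)) := ⟨_, _, hT⟩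
  have h2 : orderOf (q ModularGroup.S) ∣ 2 := by
    rw [orderOf_dvd_iff_pow_eq_one, ← map_pow, pow_two, S_mul_S, hneg]
  have h3 : orderOf (q (ModularGroup.S * ModularGroup.T)) ∣ 3 := by
    rw [orderOf_dvd_iff_pow_eq_one, ← map_pow, S_mul_T_pow_three, hneg]
  have hp' : orderOf (q ModularGroup.S * q (ModularGroup.S * ModularGroup.T)) ∣ p := by
    rw [hST, orderOf_dvd_iff_pow_eq_one, ← map_pow]
    have h1 : reduction p (ModularGroup.T ^ p) = 1 := by
      have h4 : ModularGroup.T ^ (p : ℤ) = unipT (p : ℤ) := Subtype.ext (ModularGroup.coe_T_zpow _)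
      rw [← zpow_natCast, h4, reduction_unipT]
      apply specialLinearGroup_two_ext <;> simp [coe_unipT]
    change π (reduction p _) = 1
    rw [h1, map_one]
  have c2 : Nat.Coprime 2 p := (Nat.coprime_primes Nat.prime_two hp).2 (by omega)
  have c3 : Nat.Coprime 3 p := (Nat.coprime_primes Nat.prime_three hp).2 (by omega)
  refine ⟨hfin, ⟨_, _, hgen⟩, fun hpure => ?_⟩
  let φ : FreeGroup (Fin 2) →* Matrix.ProjectiveSpecialLinearGroup (Fin 2) (ZMod p) :=
    FreeGroup.lift ![q ModularGroup.S, q (ModularGroup.S * ModularGroup.T)]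
  have hφ0 : φ (.of 0) = q ModularGroup.S := by simp [φ]
  have hφ1 : φ (.of 1) = q (ModularGroup.S * ModularGroup.T) := by simp [φ]
  have hsurj : Function.Surjective φ := by
    rw [← MonoidHom.range_eq_top, eq_top_iff, ← hgen, Subgroup.closure_le]
    rintro _ (rfl | rfl)
    · exact ⟨_, hφ0⟩
    · exact ⟨_, hφ1⟩
  exact (totallyNoncongruence_of_coprime_orders hgen
    ((by norm_num : Nat.Coprime 2 3).of_dvd h2 h3) (c2.of_dvd h2 hp') (c3.of_dvd h3 hp')
    hφ0 hφ1).2.2 (hpure φ hsurj)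

end NoncongruenceCriterion

open NoncongruenceCriterion in
theorem mainTheorem11 :
    (∀ (G : Type*) [Group G] [Finite G] [Nontrivial G] (a b : G),
      Subgroup.closure {a, b} = ⊤ →
      (orderOf a).Coprime (orderOf b) →
      (orderOf a).Coprime (orderOf (a * b)) →
      (orderOf b).Coprime (orderOf (a * b)) →
      ∀ φ : FreeGroup (Fin 2) →* G, φ (FreeGroup.of 0) = a → φ (FreeGroup.of 1) = b →
        IsTotallyNoncongruence (stabilizer φ) ∧ IsNoncongruenceSubgroup (stabilizer φ)) ∧
    (∀ p : ℕ, p.Prime → 5 ≤ p →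
      IsNoncongruenceGroup (Matrix.ProjectiveSpecialLinearGroup (Fin 2) (ZMod p))) :=
  ⟨fun _ _ _ _ _ _ hgen hab hac hbc _ ha hb =>
    totallyNoncongruence_of_coprime_orders hgen hab hac hbc ha hb,
    fun _ hp h5 => isNoncongruenceGroup_projectiveSpecialLinearGroup hp h5⟩
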